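/- **Model.** Let $\mathcal D$ and $\mathcal S$ be finite sets of demand and supply classes and let $\mathcal E\subset\mathcal D\times\mathcal S$ be such that the matching graph $(\mathcal D\cup\mathcal S,\mathcal E)$ is connected. Let $\ell=|\mathcal D|+|\mathcal S|$, let $c(x)=\sum_k c_kx_k$ be a linear cost with all $c_k>0$, and let $\bar n_u\ge 4$ be an integer. For $e=(i,j)$ put $u^e=\mathbf 1^i+\mathbf 1^j\in\mathbb Z_+^\ell$. Let $\xi^0$ be $+1$ on $\mathcal D$ and $-1$ on $\mathcal S$. The state space is $\mathsf X=\{q\in\mathbb Z_+^\ell:\xi^0\cdot q=0\}$. In each time slot one pair $(i,j)$ in a set $\mathcal A\subset\mathcal D\times\mathcal S$ of arrival pairs arrives, so that $A(t)=\mathbf 1^i+\mathbf 1^j$, and the arrivals are i.i.d. The buffers evolve as $Q(t+1)=Q(t)-U(t)+A(t)$, where $U(t)=\sum_{e\in\mathcal E}n_e u^e$ with integers $n_e\ge0$, $\sum_e n_e\le\bar n_u$ and $U(t)\le Q(t)+A(t)$ componentwise. A randomized (stationary) policy draws the numbers of matches $(n_e)$ from a probability law that depends on $(Q(t),A(t))$.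 For $D\subset\mathcal D$ let $\mathcal S(D)=\{j:(i,j)\in\mathcal E\text{ for some }i\in D\}$ and let $\xi^D$ be $+1$ on $D$, $-1$ on $\mathcal S(D)$ and $0$ elsewhere. **Assumptions.** There are $\bar\delta_\bullet\in(0,1)$ and arrival processes $A^\delta$, $0\le\delta\le\bar\delta_\bullet$, on one probability space, with values in $\{\mathbf 1^i+\mathbf 1^j:(i,j)\in\mathcal A\}$ and with means $\alpha^\delta=\mathsf E[A^\delta(t)]$, where $\alpha^0_k>0$ for every class $k$. Moreover: (A1) there are a nonempty $D\subsetneq\mathcal D$ with $\xi^D\cdot\alpha^\delta=-\delta$ for all $\delta\in[0,\bar\delta_\bullet]$, and a constant $\underline\delta>0$ with $\xi^{D'}\cdot\alpha^\delta\le-\underline\delta$ for all nonempty $D'\subsetneq\mathcal D$ with $D'\ne D$ and all $\delta\in[0,\bar\delta_\bullet]$; (A2) $\mathsf E\|A^\delta(t)-A^0(t)\|\le b\delta$ for some constant $b$ and all $\delta\in[0,\bar\delta_\bullet]$; (A3) there are $i_0\in\mathcal S(D)$, $j_0\in\mathcal D\setminus D$ and $p_I>0$ with $\mathsf P\{A^\delta_{i_0}(t)\ge1,\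 A^\delta_{j_0}(t)\ge1\}\ge p_I$ for all $\delta\in[0,\bar\delta_\bullet]$. Write $\xi=\xi^D$, $\bar c(w)=\min\{c(x):x\in\mathbb R_+^\ell,\ \xi^0\cdot x=0,\ \xi\cdot x=w\}$, and, for $\bar q\ge1$, $c_{\min}=1+4\ell\bar q\max_kc_k$. Write $X(t)=Q(t)+A(t)$, $W(t)=\xi\cdot X(t)$ and $I(t)=-\xi\cdot U(t)$. A cross-match is a match between a class in $\mathcal S(D)$ and a class in $\mathcal D\setminus D$. **Drift bounds.** A policy satisfies the drift bounds with parameters $(\delta,\bar q,\varepsilon_0,\varepsilon_0')$ if, for the arrival process $A^\delta$ and for every $q\in\mathsf X$: (i) if $c(q)<\bar c(\xi\cdot q)+c_{\min}$, then $$\mathsf E[Q_j(t+1)\mid Q(t)=q]\le q_j+\delta\quad\text{for every buffer $j$ with }q_j\ge1;\tag{1}$$ (ii) if $c(q)\ge\bar c(\xi\cdot q)+c_{\min}$, then there are distinct buffers $k,m$ with $q_k\ge\bar q$, $q_m\ge1$, $$\mathsf E[Q_k(t+1)\mid Q(t)=q]\le q_k-\varepsilon_0,$$ $$\mathsf E[c_kQ_k(t+1)+c_mQ_m(t+1)\mid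 Q(t)=q]\le c_kq_k+c_mq_m-\varepsilon_0',$$ and the inequality in (1) holds for every $j\ne m$ with $q_j\ge1$. **Lemma.** (a) There are constants $\bar\delta_0\in(0,\bar\delta_\bullet)$ and $\varepsilon_0,\varepsilon_0'>0$ such that for every $\bar q\ge1$ and every $\delta\in[0,\bar\delta_0]$ there is a randomized policy that makes no cross-match and satisfies the drift bounds with parameters $(\delta,\bar q,\varepsilon_0,\varepsilon_0')$. (b) If in addition $(j_0,i_0)\in\mathcal E$, there are constants $\bar\delta_0\in(0,\bar\delta_\bullet)$ and $\varepsilon_0,\varepsilon_0',\bar\delta_+>0$ such that for every $\bar q\ge1$, every $\delta_+\in(0,\bar\delta_+)$, every $\delta\in[0,\bar\delta_0]$ and every threshold $\tau\ge0$ there is a randomized policy that satisfies the drift bounds with parameters $(\delta,\bar q,\varepsilon_0,\varepsilon_0')$, makes no cross-match at states $q\in\mathsf X$ with $\xi\cdot q\ge-\tau$, and satisfies $$\mathsf E[I(t)\mid Q(t)=q]-\delta=\mathsf E[W(t+1)-W(t)\mid Q(t)=q]=\delta_+$$ at every state $q\in\mathsf X$ with $\xi\cdot q<-\tau$. -/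

import Mathlib

open Set MeasureTheory ProbabilityTheory

noncomputable section

namespace BipartiteMatching

/-- The data of a bipartite matching model with demand classes `Dm` and supply classes `Sp`.
A buffer is an element of `Dm ⊕ Sp`. -/
structure Model (Dm Sp : Type*) where
  /-- the matching pairs `ℰ` -/
  edges : Set (Dm × Sp)
  /-- the arrival pairs `𝒜` -/
  arrivalPairs : Set (Dm × Sp)
  /-- the coefficients of the linear cost function -/
  cost : Dm ⊕ Sp → ℝ
  /-- the maximal number of matches per time slot -/
  maxMatches : ℕ

/-- The matching graph on `Dm ⊕ Sp`. -/
def Model.graph {Dm Sp : Type*} (M : Model Dm Sp) : SimpleGraph (Dm ⊕ Sp) :=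
  SimpleGraph.fromRel fun x y => ∃ i j, x = Sum.inl i ∧ y = Sum.inr j ∧ (i, j) ∈ M.edges

/-- The standing assumptions on the model: the matching graph is connected, the cost coefficients
are positive and at least four matches per time slot are permitted. -/
structure Model.Standing {Dm Sp : Type*} (M : Model Dm Sp) : Prop where
  connected : M.graph.Connected
  cost_pos : ∀ k, 0 < M.cost k
  four_le : 4 ≤ M.maxMatches

/-- `𝒮(D)`: the supply classes that can be matched with some demand class in `D`. -/
def Model.supplyOf {Dm Sp : Type*} (M : Model Dm Sp) (D : Set Dm) : Set Sp :=
  {j | ∃ i ∈ D, (i, j) ∈ M.edges}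

/-- `ξ⁰`: equal to `1` on demand classes and to `-1` on supply classes. -/
def xi0 {Dm Sp : Type*} : Dm ⊕ Sp → ℝ :=
  Sum.elim (fun _ => 1) (fun _ => -1)

/-- The workload vector `ξ^D`: `1` on `D`, `-1` on `𝒮(D)`, zero elsewhere. -/
def Model.xi {Dm Sp : Type*} (M : Model Dm Sp) (D : Set Dm) : Dm ⊕ Sp → ℝ :=
  Sum.elim (D.indicator fun _ => 1) (fun j => -(M.supplyOf D).indicator (fun _ => 1) j)

/-- The inner product of two real vectors indexed by the buffers. -/
def dot {Dm Sp : Type*} [Fintype Dm] [Fintype Sp] (x y : Dm ⊕ Sp → ℝ) : ℝ :=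
  ∑ k, x k * y k

/-- A vector of buffer contents, seen as a real vector. -/
def toReal {Dm Sp : Type*} (q : Dm ⊕ Sp → ℕ) : Dm ⊕ Sp → ℝ := fun k => (q k : ℝ)

/-- The state space: vectors of buffer contents with as many units of demand as of supply. -/
def IsState {Dm Sp : Type*} [Fintype Dm] [Fintype Sp] (q : Dm ⊕ Sp → ℕ) : Prop :=
  dot xi0 (toReal q) = 0

/-- The vector `1^i + 1^j` of a pair `a = (i, j)`. -/
def pairVec {Dm Sp : Type*} [DecidableEq Dm] [DecidableEq Sp] (a : Dm × Sp) : Dm ⊕ Sp → ℕ :=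
  Sum.elim (fun i => if i = a.1 then 1 else 0) (fun j => if j = a.2 then 1 else 0)

/-- The vector `u = ∑ e, n e • u^e` of the numbers of units that leave the buffers when `n e`
matches are made across each pair `e`. -/
def inputVec {Dm Sp : Type*} [Fintype Dm] [Fintype Sp] [DecidableEq Dm] [DecidableEq Sp]
    (n : Dm × Sp → ℕ) : Dm ⊕ Sp → ℕ :=
  fun k => ∑ e, n e * pairVec e k

/-- The matching activities `n` that are permitted when `x` is the vector of available units:
matches are made across edges only, at most `maxMatches` of them, and no buffer becomes
negative. -/
def Model.IsFeasible {Dm Sp : Type*} [Fintype Dm] [Fintype Sp] [DecidableEq Dm] [DecidableEq Sp]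
    (M : Model Dm Sp) (x : Dm ⊕ Sp → ℕ) (n : Dm × Sp → ℕ) : Prop :=
  (∀ e, e ∉ M.edges → n e = 0) ∧ ∑ e, n e ≤ M.maxMatches ∧ ∀ k, inputVec n k ≤ x k

/-- The linear cost `c(x)`. -/
def Model.costOf {Dm Sp : Type*} [Fintype Dm] [Fintype Sp] (M : Model Dm Sp)
    (x : Dm ⊕ Sp → ℝ) : ℝ :=
  dot M.cost x

/-- The effective cost: the minimal cost of a balanced nonnegative vector with workload `w`. -/
def Model.effCost {Dm Sp : Type*} [Fintype Dm] [Fintype Sp] (M : Model Dm Sp) (D : Set Dm)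
    (w : ℝ) : ℝ :=
  sInf {r | ∃ x : Dm ⊕ Sp → ℝ, (∀ k, 0 ≤ x k) ∧ dot xi0 x = 0 ∧ dot (M.xi D) x = w ∧
    r = M.costOf x}

/-- The constant `1 + 4 ℓ q̄ max c`, where `ℓ` is the number of buffers. -/
def Model.minCost {Dm Sp : Type*} [Fintype Dm] [Fintype Sp] (M : Model Dm Sp) (qbar : ℝ) : ℝ :=
  1 + 4 * (Fintype.card (Dm ⊕ Sp) : ℝ) * qbar * ⨆ k, M.cost k

/-- A randomized stationary policy: to a vector `q` of buffer contents and an arriving pair `a` it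
assigns the law of the matching activities, among those permitted when `q + a` is available. -/
structure Policy {Dm Sp : Type*} [Fintype Dm] [Fintype Sp] [DecidableEq Dm] [DecidableEq Sp]
    (M : Model Dm Sp) where
  law : (Dm ⊕ Sp → ℕ) → Dm × Sp → PMF (Dm × Sp → ℕ)
  feasible : ∀ q a, ∀ n ∈ (law q a).support, M.IsFeasible (q + pairVec a) n

/-- The policy makes no match between `𝒮(D)` and the complement of `D` when the vector of buffer
contents is `q`. -/
def Policy.NoCrossMatchingAt {Dm Sp : Type*} [Fintype Dm] [Fintype Sp] [DecidableEq Dm]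
    [DecidableEq Sp] {M : Model Dm Sp} (ψ : Policy M) (D : Set Dm) (q : Dm ⊕ Sp → ℕ) : Prop :=
  ∀ a, ∀ n ∈ (ψ.law q a).support, ∀ i j, i ∉ D → j ∈ M.supplyOf D → n (i, j) = 0

/-- The conditional expectation `E[f(A(t), n(t)) | Q(t) = q]`, where the arriving pair `A(t)` has
probabilities `p`, independently of `Q(t)`, and the matching activities `n(t)` are drawn from the
policy. (Only finitely many activities are permitted, so the inner sum is a finite one.) -/
def Policy.condExp {Dm Sp : Type*} [Fintype Dm] [Fintype Sp] [DecidableEq Dm]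
    [DecidableEq Sp] {M : Model Dm Sp} (ψ : Policy M) (p : Dm × Sp → ℝ) (q : Dm ⊕ Sp → ℕ)
    (f : Dm × Sp → (Dm × Sp → ℕ) → ℝ) : ℝ :=
  ∑ a, p a * ∑' n, (ψ.law q a n).toReal * f a n

/-- The vector `Q(t+1) = Q(t) - U(t) + A(t)`. -/
def nextState {Dm Sp : Type*} [Fintype Dm] [Fintype Sp] [DecidableEq Dm] [DecidableEq Sp]
    (q : Dm ⊕ Sp → ℕ) (a : Dm × Sp) (n : Dm × Sp → ℕ) : Dm ⊕ Sp → ℝ :=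
  toReal q - toReal (inputVec n) + toReal (pairVec a)

/-- `E[Q_k(t+1) | Q(t) = q]`. -/
def Policy.meanNext {Dm Sp : Type*} [Fintype Dm] [Fintype Sp] [DecidableEq Dm]
    [DecidableEq Sp] {M : Model Dm Sp} (ψ : Policy M) (p : Dm × Sp → ℝ) (q : Dm ⊕ Sp → ℕ)
    (k : Dm ⊕ Sp) : ℝ :=
  ψ.condExp p q fun a n => nextState q a n k

/-- `E[c_k Q_k(t+1) + c_m Q_m(t+1) | Q(t) = q]`. -/
def Policy.meanNextCost {Dm Sp : Type*} [Fintype Dm] [Fintype Sp] [DecidableEq Dm]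
    [DecidableEq Sp] {M : Model Dm Sp} (ψ : Policy M) (p : Dm × Sp → ℝ) (q : Dm ⊕ Sp → ℕ)
    (k m : Dm ⊕ Sp) : ℝ :=
  ψ.condExp p q fun a n => M.cost k * nextState q a n k + M.cost m * nextState q a n m

/-- The mean idleness `E[I(t) | Q(t) = q]`, with `I(t) = -ξ^D ⬝ U(t)`. -/
def Policy.meanIdleness {Dm Sp : Type*} [Fintype Dm] [Fintype Sp] [DecidableEq Dm]
    [DecidableEq Sp] {M : Model Dm Sp} (ψ : Policy M) (p : Dm × Sp → ℝ) (D : Set Dm)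
    (q : Dm ⊕ Sp → ℕ) : ℝ :=
  ψ.condExp p q fun _ n => -dot (M.xi D) (toReal (inputVec n))

/-- `E[W(t+1) - W(t) | Q(t) = q]`, with `W(t) = ξ^D ⬝ X(t)` and `X(t) = Q(t) + A(t)`; here
`a'` is the arrival at time `t + 1`, which is independent of the past. -/
def Policy.meanWorkloadDrift {Dm Sp : Type*} [Fintype Dm] [Fintype Sp] [DecidableEq Dm]
    [DecidableEq Sp] {M : Model Dm Sp} (ψ : Policy M) (p : Dm × Sp → ℝ) (D : Set Dm)
    (q : Dm ⊕ Sp → ℕ) : ℝ :=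
  ψ.condExp p q fun a n => ∑ a', p a' *
    (dot (M.xi D) (nextState q a n + toReal (pairVec a'))
      - dot (M.xi D) (toReal q + toReal (pairVec a)))

/-- The two uniform drift bounds. In both, `δ` bounds the drift of the nonempty buffers; if the
cost exceeds the effective cost by at least `minCost`, there is a buffer `k` with at least `qbar`
units and another nonempty buffer `m`, the only one exempt from that bound, such that `k` and the
pair `k, m` have strictly negative drift. -/
def Policy.DriftBounds {Dm Sp : Type*} [Fintype Dm] [Fintype Sp] [DecidableEq Dm]
    [DecidableEq Sp] {M : Model Dm Sp} (ψ : Policy M) (p : Dm × Sp → ℝ) (D : Set Dm)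
    (δ qbar ε₀ ε₀' : ℝ) : Prop :=
  ∀ q : Dm ⊕ Sp → ℕ, IsState q →
    (M.costOf (toReal q) < M.effCost D (dot (M.xi D) (toReal q)) + M.minCost qbar →
      ∀ j, 1 ≤ q j → ψ.meanNext p q j ≤ q j + δ) ∧
    (M.effCost D (dot (M.xi D) (toReal q)) + M.minCost qbar ≤ M.costOf (toReal q) →
      ∃ k m, k ≠ m ∧ qbar ≤ q k ∧ 1 ≤ q m ∧
        ψ.meanNext p q k ≤ q k - ε₀ ∧
        ψ.meanNextCost p q k m ≤ M.cost k * q k + M.cost m * q m - ε₀' ∧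
        ∀ j, j ≠ m → 1 ≤ q j → ψ.meanNext p q j ≤ q j + δ)

/-- The probabilities of the arriving pairs in the `δ`-th model. -/
def arrivalProb {Dm Sp Ω : Type*} [MeasurableSpace Ω] (P : Measure Ω)
    (A : ℝ → ℕ → Ω → Dm × Sp) (δ : ℝ) (a : Dm × Sp) : ℝ :=
  P.real {ω | A δ 0 ω = a}

/-- The mean arrival rate vector `α^δ`. -/
def rate {Dm Sp Ω : Type*} [DecidableEq Dm] [DecidableEq Sp] [MeasurableSpace Ω] (P : Measure Ω)
    (A : ℝ → ℕ → Ω → Dm × Sp) (δ : ℝ) (k : Dm ⊕ Sp) : ℝ :=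
  ∫ ω, (pairVec (A δ 0 ω) k : ℝ) ∂P

/-- The heavy-traffic assumptions on a family of arrival processes `A δ t`, `0 ≤ δ ≤ δbar`, all
defined on one probability space; `A δ t ω` is the pair of classes that arrives at time `t`. -/
structure HeavyTraffic {Dm Sp Ω : Type*} [Fintype Dm] [Fintype Sp] [DecidableEq Dm]
    [DecidableEq Sp] [MeasurableSpace Ω] (M : Model Dm Sp) (P : Measure Ω)
    (A : ℝ → ℕ → Ω → Dm × Sp) (δbar : ℝ) (D : Set Dm) (i₀ : Sp) (j₀ : Dm) : Prop where
  δbar_pos : 0 < δbar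
  δbar_lt_one : δbar < 1
  /-- each `A δ` is an i.i.d. sequence with values in the arrival pairs -/
  measurable : ∀ δ ∈ Icc 0 δbar, ∀ t, @Measurable Ω (Dm × Sp) _ ⊤ (A δ t)
  indep : ∀ δ ∈ Icc 0 δbar, iIndepFun (m := fun _ => ⊤) (A δ) P
  ident : ∀ δ ∈ Icc 0 δbar, ∀ t a, P {ω | A δ t ω = a} = P {ω | A δ 0 ω = a}
  mem_pairs : ∀ δ ∈ Icc 0 δbar, ∀ t, ∀ᵐ ω ∂P, A δ t ω ∈ M.arrivalPairs
  /-- every class has a positive arrival rate at `δ = 0` -/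
  rate_pos : ∀ k, 0 < rate P A 0 k
  /-- the critical workload direction `D` -/
  D_nonempty : D.Nonempty
  D_ne_univ : D ≠ univ
  workload : ∀ δ ∈ Icc 0 δbar, dot (M.xi D) (rate P A δ) = -δ
  gap : ∃ δgap > 0, ∀ D' : Set Dm, D'.Nonempty → D' ≠ univ → D' ≠ D → ∀ δ ∈ Icc 0 δbar,
    dot (M.xi D') (rate P A δ) ≤ -δgap
  /-- continuity at `δ = 0` with linear rate, in the Euclidean norm -/
  continuity : ∃ b : ℝ, ∀ δ ∈ Icc 0 δbar, ∀ t,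
    ∫ ω, ‖WithLp.toLp 2 (toReal (pairVec (A δ t ω)) - toReal (pairVec (A 0 t ω)))‖ ∂P ≤ b * δ
  /-- joint arrivals of the classes `i₀ ∈ 𝒮(D)` and `j₀ ∉ D` -/
  i₀_mem : i₀ ∈ M.supplyOf D
  j₀_notMem : j₀ ∉ D
  joint : ∃ pI > 0, ∀ δ ∈ Icc 0 δbar, ∀ t, pI ≤ P.real {ω | A δ t ω = (j₀, i₀)}

end BipartiteMatching

end

/-! Fix a state and let `K` be the set of nonempty buffers. Apart from one forced match, an arriving
unit is matched only with stored units, never across `𝒮(D)` and the complement of `D`. A stationary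
rule of this kind is a flow `f`, where `f v u` is the rate at which arrivals of class `v` consume
stock in buffer `u`; only `u ∈ K` may receive flow. The drift of a buffer is its arrival rate minus
outflow minus inflow, so both drift bounds become statements about flows, and `exists_law` turns any
admissible flow into a law with exactly these means.

A nonempty buffer with a nonempty neighbour can match all its arrivals and thus has drift at most
zero. The others (`isolated`) can be served only by arrivals to empty neighbours, and a fractional
Hall theorem (`exists_flow_of_hall`) decides at which rates. Without cross-matches the graph splits
into two parts, each with a demand block and a supply block. The gap assumption gives uniform Hall
slack for a proper part of a block, while an entire block may fall short by `δ`; this yields drift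
at most `δ` everywhere (`HasSlack.exists_flow_drift_le`).

For the strict bound a buffer `k` with at least `q̄` units is needed whose service can be increased:
`k` is matched with a nonempty neighbour, or some member of its block is not isolated and
proper-subset slack is available, or service is shifted to `k` from a cheaper class `m` of its block
(`HasSlack.exists_flow_drift_neg`). If no large buffer qualifies, each one has minimal cost in its
block and faces empty neighbours, so the cost exceeds the effective cost by at most `ℓ q̄ max c`
(`exists_large`).

For idleness, the pair `(j₀, i₀)` is matched on arrival at rate `η = δ + δ₊`. All other matches
leave the workload unchanged, so the mean idleness is exactly `η`. Removing these arrivals tightens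
Hall's condition for a full block only in cases that negative workload excludes (`HasGap.hasSlack`).
-/

noncomputable section

namespace BipartiteMatching

/-! ### Fractional Hall theorem. -/

section Flow

variable {V : Type*} [Fintype V]

open Classical in
/-- The set of neighbours of `T`. -/
def nbr (r : V → V → Prop) (T : Finset V) : Finset V :=
  Finset.univ.filter fun v => ∃ u ∈ T, r v u

theorem mem_nbr {r : V → V → Prop} {T : Finset V} {v : V} :
    v ∈ nbr r T ↔ ∃ u ∈ T, r v u := by
  simp [nbr]

/-- Hall's condition, integrated against a nonnegative function on the left-hand side. -/
theorem sum_mul_le_of_hall (r : V → V → Prop) (α β : V → ℝ) (hα : ∀ v, 0 ≤ α v) (S : Finset V)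
    (hall : ∀ T ⊆ S, ∑ u ∈ T, β u ≤ ∑ v ∈ nbr r T, α v) (y M : V → ℝ)
    (hy : ∀ u ∈ S, 0 ≤ y u) (hM : ∀ v, 0 ≤ M v) (hyM : ∀ v, ∀ u ∈ S, r v u → y u ≤ M v) :
    ∑ u ∈ S, β u * y u ≤ ∑ v, α v * M v := by
  classical
  induction h : (S.filter fun u => 0 < y u).card using Nat.strong_induction_on
    generalizing y M with
  | _ N ih =>
    set T := S.filter fun u => 0 < y u with hT
    have hTS : T ⊆ S := Finset.filter_subset _ _
    have hy0 : ∀ u ∈ S, u ∉ T → y u = 0 := by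
      intro u hu huT
      have : ¬ 0 < y u := fun h' => huT (by simp [hT, hu, h'])
      exact le_antisymm (not_lt.1 this) (hy u hu)
    rcases T.eq_empty_or_nonempty with hE | hne
    · rw [Finset.sum_eq_zero fun u hu => by rw [hy0 u hu (by simp [hE]), mul_zero]]
      exact Finset.sum_nonneg fun v _ => mul_nonneg (hα v) (hM v)
    · obtain ⟨u₀, hu₀, hmin⟩ := Finset.exists_min_image T y hne
      have hm : 0 < y u₀ := (Finset.mem_filter.1 hu₀).2
      set m := y u₀ with hm_def
      -- Layer-cake step: subtracting the least positive value `m` from `y` on its support `T`, and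
      -- from `M` on the neighbours of `T`, changes the two sides by `m β(T)` and `m α(nbr T)`,
      -- which Hall's condition compares. The minimiser `u₀` leaves the support, so the induction
      -- proceeds.
      have key := ih (S.filter fun u => 0 < (if u ∈ T then y u - m else y u)).card ?_
        (fun u => if u ∈ T then y u - m else y u)
        (fun v => if v ∈ nbr r T then M v - m else M v) ?_ ?_ ?_ rfl
      · have hext : ∀ (T' S' : Finset V) (a : V → ℝ), T' ⊆ S' →
            m * ∑ u ∈ T', a u = ∑ u ∈ S', if u ∈ T' then m * a u else 0 := by
          intro T' S' a hsub
          rw [Finset.sum_ite_mem, Finset.inter_eq_right.2 hsub, Finset.mul_sum]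
        have e1 : ∑ u ∈ S, β u * y u
            = ∑ u ∈ S, β u * (if u ∈ T then y u - m else y u) + m * ∑ u ∈ T, β u := by
          rw [hext T S β hTS, ← Finset.sum_add_distrib]
          refine Finset.sum_congr rfl fun u _ => ?_
          split_ifs <;> ring
        have e2 : ∑ v, α v * M v
            = ∑ v, α v * (if v ∈ nbr r T then M v - m else M v) + m * ∑ v ∈ nbr r T, α v := by
          rw [hext _ _ α (Finset.subset_univ (nbr r T)), ← Finset.sum_add_distrib]
          refine Finset.sum_congr rfl fun u _ => ?_
          split_ifs <;> ring
        rw [e1, e2]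
        exact add_le_add key (mul_le_mul_of_nonneg_left (hall T hTS) hm.le)
      · rw [← h]
        refine Finset.card_lt_card ⟨fun u hu => ?_, fun hsub => ?_⟩
        · obtain ⟨huS, hu⟩ := Finset.mem_filter.1 hu
          by_cases huT : u ∈ T
          · exact huT
          · rw [if_neg huT, hy0 u huS huT] at hu
            exact absurd hu (lt_irrefl _)
        · have := (Finset.mem_filter.1 (hsub hu₀)).2
          rw [if_pos hu₀] at this
          linarith
      · intro u hu
        split_ifs with huT
        · linarith [hmin u huT]
        · exact hy u hu
      · intro v
        split_ifs with hv
        · obtain ⟨u, hu, hr⟩ := mem_nbr.1 hv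
          linarith [hmin u hu, hyM v u (hTS hu) hr]
        · exact hM v
      · intro v u hu hr
        by_cases huT : u ∈ T
        · rw [if_pos huT, if_pos (mem_nbr.2 ⟨u, huT, hr⟩)]
          linarith [hyM v u hu hr]
        · rw [if_neg huT, hy0 u hu huT]
          split_ifs with hv
          · obtain ⟨u, hu, hr⟩ := mem_nbr.1 hv
            linarith [hmin u hu, hyM v u (hTS hu) hr]
          · exact hM v

/-- The flows that send at most `α v` out of `v`, along `r`, into `S`. -/
def flowSet (r : V → V → Prop) (α : V → ℝ) (S : Finset V) : Set (V → V → ℝ) :=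
  {f | (∀ v u, 0 ≤ f v u) ∧ (∀ v u, ¬ (r v u ∧ u ∈ S) → f v u = 0) ∧ ∀ v, ∑ u, f v u ≤ α v}

theorem convex_flowSet (r : V → V → Prop) (α : V → ℝ) (S : Finset V) :
    Convex ℝ (flowSet r α S) := by
  rintro f ⟨f1, f2, f3⟩ g ⟨g1, g2, g3⟩ a b ha hb hab
  refine ⟨fun v u => ?_, fun v u h => ?_, fun v => ?_⟩
  · exact add_nonneg (mul_nonneg ha (f1 v u)) (mul_nonneg hb (g1 v u))
  · simp [f2 v u h, g2 v u h]
  · simp only [Pi.add_apply, Pi.smul_apply, smul_eq_mul, Finset.sum_add_distrib, ← Finset.mul_sum]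
    have := mul_le_mul_of_nonneg_left (f3 v) ha
    have := mul_le_mul_of_nonneg_left (g3 v) hb
    have : a * α v + b * α v = α v := by rw [← add_mul, hab, one_mul]
    linarith

theorem isCompact_flowSet (r : V → V → Prop) (α : V → ℝ) (S : Finset V) :
    IsCompact (flowSet r α S) := by
  refine IsCompact.of_isClosed_subset
    (isCompact_univ_pi fun v => isCompact_univ_pi fun _ => isCompact_Icc (a := 0) (b := α v)) ?_ ?_
  · have : flowSet r α S = (⋂ v, ⋂ u, {f | 0 ≤ f v u}) ∩
        ((⋂ v, ⋂ u, ⋂ _ : ¬ (r v u ∧ u ∈ S), {f | f v u = 0}) ∩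
          ⋂ v, {f | ∑ u, f v u ≤ α v}) := by
      ext f; simp [flowSet]
    rw [this]
    refine (isClosed_iInter fun v => isClosed_iInter fun u => ?_).inter
      ((isClosed_iInter fun v => isClosed_iInter fun u => isClosed_iInter fun _ => ?_).inter
        (isClosed_iInter fun v => ?_))
    · exact isClosed_le (by fun_prop) (by fun_prop)
    · exact isClosed_eq (by fun_prop) (by fun_prop)
    · exact isClosed_le (by fun_prop) (by fun_prop)
  · rintro f ⟨f1, -, f3⟩ v - u -
    exact ⟨f1 v u, (Finset.single_le_sum (fun u _ => f1 v u) (Finset.mem_univ u)).trans (f3 v)⟩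

/-- The fractional version of Hall's marriage theorem. -/
theorem exists_flow_of_hall (r : V → V → Prop) (α β : V → ℝ) (hα : ∀ v, 0 ≤ α v) (S : Finset V)
    (hall : ∀ T ⊆ S, ∑ u ∈ T, β u ≤ ∑ v ∈ nbr r T, α v) :
    ∃ f ∈ flowSet r α S, ∀ u ∈ S, β u ≤ ∑ v, f v u := by
  classical
  by_contra! hcon
  let Φ : (V → V → ℝ) →ₗ[ℝ] (V → ℝ) :=
    { toFun := fun f u => ∑ v, f v u
      map_add' := fun f g => by ext u; simp [Finset.sum_add_distrib]
      map_smul' := fun c f => by ext u; simp [Finset.mul_sum] }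
  have hΦ : ∀ f u, Φ f u = ∑ v, f v u := fun _ _ => rfl
  have hΦc : Continuous Φ := by
    refine continuous_pi fun u => ?_
    simp only [hΦ]
    fun_prop
  have hclosed : IsClosed {b : V → ℝ | ∀ u ∈ S, β u ≤ b u} := by
    simp only [Set.ofPred_forall]
    exact isClosed_iInter fun u => isClosed_iInter fun _ => isClosed_le (by fun_prop) (by fun_prop)
  have hconv : Convex ℝ {b : V → ℝ | ∀ u ∈ S, β u ≤ b u} := by
    intro x hx y hy a b ha hb hab u hu
    have h1 := mul_le_mul_of_nonneg_left (hx u hu) ha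
    have h2 := mul_le_mul_of_nonneg_left (hy u hu) hb
    have : a * β u + b * β u = β u := by rw [← add_mul, hab, one_mul]
    simp only [Pi.add_apply, Pi.smul_apply, smul_eq_mul]
    linarith
  -- If no flow meets the demand `β`, the compact convex set of achievable inflows is disjoint from
  -- the closed convex set of vectors dominating `β` on `S`.
  obtain ⟨g, s, t, hs, hst, ht⟩ := geometric_hahn_banach_compact_closed
    ((convex_flowSet r α S).linear_image Φ) ((isCompact_flowSet r α S).image hΦc) hconv hclosed
    (by
      rw [Set.disjoint_left]
      rintro _ ⟨f, hf, rfl⟩ hb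
      obtain ⟨u, hu, hlt⟩ := hcon f hf
      exact absurd (hb u hu) (not_le.2 hlt))
  set y : V → ℝ := fun u => g (Pi.single u 1) with hy_def
  have hg : ∀ b, g b = ∑ u, b u * y u := by
    intro b
    conv_lhs => rw [← Finset.univ_sum_single b]
    rw [map_sum]
    refine Finset.sum_congr rfl fun u _ => ?_
    have : (Pi.single u (b u) : V → ℝ) = b u • Pi.single u 1 := by
      rw [← Pi.single_smul, smul_eq_mul, mul_one]
    rw [this, map_smul, smul_eq_mul]
  -- The separating functional is bounded below along these rays, which forces `y ≥ 0` on `S` and `y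
  -- = 0` off `S`.
  have hray : ∀ u, ∀ c : ℝ, (u ∈ S → 0 ≤ c) → t < g β + c * y u := by
    intro u c hc
    have := ht (β + c • Pi.single u 1) (by
      intro u' hu'
      by_cases h : u' = u
      · subst h; simpa using hc hu'
      · simp [h])
    rwa [map_add, map_smul, smul_eq_mul] at this
  have hyS : ∀ u ∈ S, 0 ≤ y u := by
    intro u hu
    by_contra! hneg
    have h := hray u ((|t| + |g β|) / (-y u)) (fun _ => by
      have : 0 < -y u := by linarith
      positivity)
    have : (|t| + |g β|) / (-y u) * y u = -(|t| + |g β|) := by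
      rw [div_neg, neg_mul, div_mul_cancel₀ _ hneg.ne]
    rw [this] at h
    linarith [le_abs_self (g β), neg_abs_le t]
  have hy0 : ∀ u, u ∉ S → y u = 0 := by
    intro u hu
    by_contra hne
    have h := hray u (-(|t| + |g β|) / (y u)) (fun h => absurd h hu)
    rw [div_mul_cancel₀ _ hne] at h
    linarith [le_abs_self (g β), neg_abs_le t]
  -- The flow of largest value against `y` sends all of `α v` to the neighbour in `S` where `y` is
  -- largest. Its value `∑ α v * M v` bounds `∑ β u * y u` by Hall's condition, contradicting
  -- separation.
  have hmax : ∀ v, ∃ f : V → ℝ, (∀ u, 0 ≤ f u) ∧ (∀ u, ¬ (r v u ∧ u ∈ S) → f u = 0) ∧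
      ∑ u, f u ≤ α v ∧ ∃ M, 0 ≤ M ∧ (∀ u ∈ S, r v u → y u ≤ M) ∧ ∑ u, f u * y u = α v * M := by
    intro v
    rcases (S.filter fun u => r v u).eq_empty_or_nonempty with hE | hne
    · refine ⟨0, fun _ => le_rfl, fun _ _ => rfl, by simpa using hα v, 0, le_rfl, ?_, by simp⟩
      intro u hu hr
      exact absurd (Finset.mem_filter.2 ⟨hu, hr⟩) (by simp [hE])
    · obtain ⟨u₀, hu₀, hm⟩ := Finset.exists_max_image _ y hne
      obtain ⟨hu₀S, hr₀⟩ := Finset.mem_filter.1 hu₀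
      refine ⟨Pi.single u₀ (α v), ?_, ?_, by simp, y u₀, hyS _ hu₀S, ?_, ?_⟩
      · intro u
        by_cases h : u = u₀
        · subst h; simpa using hα v
        · simp [h]
      · intro u hu
        have : u ≠ u₀ := by rintro rfl; exact hu ⟨hr₀, hu₀S⟩
        simp [this]
      · exact fun u hu hr => hm u (Finset.mem_filter.2 ⟨hu, hr⟩)
      · simp [Pi.single_apply]
  choose f f1 f2 f3 M hM0 hM1 hM2 using hmax
  have hf : f ∈ flowSet r α S := ⟨f1, f2, f3⟩
  have h1 := hs _ ⟨f, hf, rfl⟩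
  have h2 := ht β (fun _ _ => le_rfl)
  have h3 := sum_mul_le_of_hall r α β hα S hall y M hyS hM0 hM1
  rw [hg] at h1 h2
  have h4 : ∑ u, Φ f u * y u = ∑ v, α v * M v := by
    simp only [hΦ, Finset.sum_mul]
    rw [Finset.sum_comm]
    exact Finset.sum_congr rfl fun v _ => hM2 v
  have h5 : ∑ u, β u * y u = ∑ u ∈ S, β u * y u := by
    symm
    refine Finset.sum_subset (Finset.subset_univ _) fun u _ hu => ?_
    rw [hy0 u hu, mul_zero]
  linarith

end Flow

/-! ### Flows with prescribed drift. -/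

section Drift

variable {V : Type*} [Fintype V]

open Classical in
/-- The members of `K` that have no neighbour in `K`. -/
def isolated (r : V → V → Prop) (K : Finset V) : Finset V :=
  K.filter fun v => ∀ u ∈ K, ¬ r v u

theorem mem_isolated {r : V → V → Prop} {K : Finset V} {v : V} :
    v ∈ isolated r K ↔ v ∈ K ∧ ∀ u ∈ K, ¬ r v u := by
  simp [isolated]

/-- The drift of the buffer `k` under the arrival rates `α`, if the arrivals to `v` are matched
with units of buffer `u` at the rate `f v u`. -/
def drift (α : V → ℝ) (f : V → V → ℝ) (k : V) : ℝ := α k - ∑ u, f k u - ∑ u, f u k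

/-- The sources divide into three kinds. Arrivals to an isolated buffer just join it, arrivals to
any other nonempty buffer `v` all consume stock of the partner `φ v`, and arrivals to empty buffers
follow a Hall flow into the isolated ones. Neighbours of isolated buffers are empty, so the Hall
flow is unaffected by the other two rules. -/
theorem exists_flow_of_stock {r : V → V → Prop} (hr : ∀ v u, r v u → r u v) {α β : V → ℝ}
    (hα : ∀ v, 0 ≤ α v) {K : Finset V} {φ : V → V}
    (hφ : ∀ v ∈ K, v ∉ isolated r K → φ v ∈ K ∧ r v (φ v))
    (hall : ∀ T ⊆ isolated r K, ∑ u ∈ T, β u ≤ ∑ v ∈ nbr r T, α v) :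
    ∃ f ∈ flowSet r α K, (∀ v ∈ isolated r K, drift α f v ≤ α v - β v) ∧
      ∀ v ∈ K, v ∉ isolated r K → ∑ u, f v u = α v ∧ f v (φ v) = α v := by
  classical
  obtain ⟨g, ⟨g1, g2, g3⟩, g4⟩ := exists_flow_of_hall r α β hα _ hall
  let f : V → V → ℝ := fun v u =>
    if v ∈ K then (if v ∈ isolated r K then 0 else if u = φ v then α v else 0) else g v u
  have hK : ∀ v ∈ K, v ∉ isolated r K → ∀ u, f v u = if u = φ v then α v else 0 := by
    intro v hv hv' u
    simp only [f, if_pos hv, if_neg hv']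
  have hI : ∀ v ∈ isolated r K, ∀ u, f v u = 0 := by
    intro v hv u
    simp only [f, if_pos (mem_isolated.1 hv).1, if_pos hv]
  have hN : ∀ v ∉ K, ∀ u, f v u = g v u := by
    intro v hv u
    simp only [f, if_neg hv]
  have f1 : ∀ v u, 0 ≤ f v u := by
    intro v u
    by_cases hv : v ∈ K
    · by_cases hv' : v ∈ isolated r K
      · rw [hI v hv']
      · rw [hK v hv hv']
        split_ifs
        exacts [hα v, le_rfl]
    · rw [hN v hv]
      exact g1 v u
  have hsum : ∀ v ∈ K, v ∉ isolated r K → ∑ u, f v u = α v := by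
    intro v hv hv'
    simp [hK v hv hv']
  refine ⟨f, ⟨f1, fun v u h => ?_, fun v => ?_⟩, fun v hv => ?_, fun v hv hv' => ⟨hsum v hv hv', ?_⟩⟩
  · by_cases hv : v ∈ K
    · by_cases hv' : v ∈ isolated r K
      · exact hI v hv' u
      · rw [hK v hv hv', if_neg]
        rintro rfl
        exact h ⟨(hφ v hv hv').2, (hφ v hv hv').1⟩
    · rw [hN v hv]
      exact g2 v u fun h' => h ⟨h'.1, (mem_isolated.1 h'.2).1⟩
  · by_cases hv : v ∈ K
    · by_cases hv' : v ∈ isolated r K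
      · simpa [hI v hv'] using hα v
      · exact (hsum v hv hv').le
    · simpa [hN v hv] using g3 v
  · have h1 : ∑ u, f v u = 0 := Finset.sum_eq_zero fun u _ => hI v hv u
    have h2 : ∑ u, g u v ≤ ∑ u, f u v := by
      refine Finset.sum_le_sum fun u _ => ?_
      by_cases hu : u ∈ K
      · rw [g2 u v fun h => (mem_isolated.1 hv).2 u hu (hr _ _ h.1)]
        exact f1 u v
      · rw [hN u hu]
    have := g4 v hv
    unfold drift
    linarith
  · rw [hK v hv hv', if_pos rfl]

/-- Hall's condition may be verified separately in each block, if the neighbours of a vertex all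
lie in one block. -/
theorem hall_of_blocks {ι : Type*} [Fintype ι] [DecidableEq ι] {r : V → V → Prop} {blk : V → ι}
    (hblk : ∀ v u u', r v u → r v u' → blk u = blk u') {α β : V → ℝ} (hα : ∀ v, 0 ≤ α v)
    {S : Finset V}
    (h : ∀ b, ∀ T ⊆ S, (∀ v ∈ T, blk v = b) → T.Nonempty →
      ∑ u ∈ T, β u ≤ ∑ v ∈ nbr r T, α v) :
    ∀ T ⊆ S, ∑ u ∈ T, β u ≤ ∑ v ∈ nbr r T, α v := by
  classical
  intro T hT
  rw [← Finset.sum_fiberwise T blk β]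
  have hdisj : ((Finset.univ : Finset ι) : Set ι).PairwiseDisjoint
      fun b => nbr r (T.filter fun v => blk v = b) := by
    intro b _ b' _ hne
    rw [Function.onFun, Finset.disjoint_left]
    intro v hv hv'
    obtain ⟨u, hu, hr⟩ := mem_nbr.1 hv
    obtain ⟨u', hu', hr'⟩ := mem_nbr.1 hv'
    exact hne ((Finset.mem_filter.1 hu).2.symm.trans
      ((hblk v u u' hr hr').trans (Finset.mem_filter.1 hu').2))
  calc ∑ b, ∑ u ∈ T with blk u = b, β u
      ≤ ∑ b, ∑ v ∈ nbr r (T.filter fun v => blk v = b), α v := by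
        refine Finset.sum_le_sum fun b _ => ?_
        rcases (T.filter fun v => blk v = b).eq_empty_or_nonempty with hE | hne
        · rw [hE, Finset.sum_empty]
          exact Finset.sum_nonneg fun v _ => hα v
        · exact h b _ ((Finset.filter_subset _ _).trans hT)
            (fun v hv => (Finset.mem_filter.1 hv).2) hne
    _ = ∑ v ∈ Finset.univ.biUnion fun b => nbr r (T.filter fun v => blk v = b), α v :=
        (Finset.sum_biUnion hdisj).symm
    _ ≤ ∑ v ∈ nbr r T, α v := by
        refine Finset.sum_le_sum_of_subset_of_nonneg (fun v hv => ?_) fun v _ _ => hα v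
        obtain ⟨b, -, hb⟩ := Finset.mem_biUnion.1 hv
        obtain ⟨u, hu, hr⟩ := mem_nbr.1 hb
        exact mem_nbr.2 ⟨u, (Finset.mem_filter.1 hu).1, hr⟩

/-- The slack in Hall's condition: `γ` for a proper part of a block, and `-δ` for a block none of
whose members has a neighbour in the set `K`. -/
structure HasSlack {ι : Type*} (r : V → V → Prop) (blk : V → ι) (α : V → ℝ) (γ δ : ℝ)
    (K : Finset V) : Prop where
  symm : ∀ v u, r v u → r u v
  irrefl : ∀ v, ¬ r v v
  block : ∀ v u u', r v u → r v u' → blk u = blk u'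
  pos : 0 < γ
  nonneg : 0 ≤ δ
  le_rate : ∀ v, γ ≤ α v
  proper : ∀ b, ∀ T : Finset V, T.Nonempty → (∀ v ∈ T, blk v = b) → (∃ v, blk v = b ∧ v ∉ T) →
    ∑ v ∈ T, α v + γ ≤ ∑ v ∈ nbr r T, α v
  full : ∀ b, ∀ T ⊆ isolated r K, T.Nonempty → (∀ v, v ∈ T ↔ blk v = b) →
    ∑ v ∈ T, α v ≤ ∑ v ∈ nbr r T, α v + δ

variable {ι : Type*} [Fintype ι] [DecidableEq ι] {r : V → V → Prop} {blk : V → ι} {α : V → ℝ}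
  {γ δ : ℝ} {K : Finset V}

/-- Hall's theorem is applied with the demand `α - δ + s`. The perturbation `s` redistributes
service among isolated buffers: on a proper part of a block it may use the slack `γ + δ`, on a full
block it must not increase the total. If `φ` pairs two nonisolated buffers mutually, each consumes
the other's stock, which gains a further `γ`. -/
theorem HasSlack.exists_flow [DecidableEq V] (H : HasSlack r blk α γ δ K) {φ : V → V}
    (hφ : ∀ v ∈ K, v ∉ isolated r K → φ v ∈ K ∧ r v (φ v)) (s : V → ℝ)
    (hs : ∀ b, ∀ T ⊆ isolated r K, (∀ v ∈ T, blk v = b) → ∑ v ∈ T, s v ≤ γ + δ)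
    (hs' : ∀ b, ∀ T ⊆ isolated r K, (∀ v, v ∈ T ↔ blk v = b) → T.Nonempty → ∑ v ∈ T, s v ≤ 0) :
    ∃ f ∈ flowSet r α K, (∀ v ∈ isolated r K, drift α f v ≤ δ - s v) ∧
      (∀ v ∈ K, v ∉ isolated r K → drift α f v ≤ 0) ∧
      ∀ v ∈ K, v ∉ isolated r K → φ (φ v) = v → φ v ∉ isolated r K →
        drift α f v ≤ - γ := by
  have hα : ∀ v, 0 ≤ α v := fun v => H.pos.le.trans (H.le_rate v)
  obtain ⟨f, hf, f1, f2⟩ := exists_flow_of_stock H.symm (β := fun v => α v - δ + s v) hα hφ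
    (hall_of_blocks H.block hα fun b T hT hb hne => by
      obtain ⟨v₀, hv₀⟩ := hne
      -- Every buffer is allowed a drift of `δ`, so a single member of `T` already compensates for
      -- the deficit `δ` of a full block.
      have hcard : δ ≤ ∑ v ∈ T, δ := Finset.single_le_sum (f := fun _ => δ)
        (fun _ _ => H.nonneg) hv₀
      rw [Finset.sum_add_distrib, Finset.sum_sub_distrib]
      by_cases hp : ∃ v, blk v = b ∧ v ∉ T
      · have := H.proper b T ⟨v₀, hv₀⟩ hb hp
        have := hs b T hT hb
        linarith
      · push Not at hp
        have hiff : ∀ v, v ∈ T ↔ blk v = b := fun v => ⟨hb v, hp v⟩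
        have := H.full b T hT ⟨v₀, hv₀⟩ hiff
        have := hs' b T hT hiff ⟨v₀, hv₀⟩
        linarith)
  refine ⟨f, hf, fun v hv => ?_, fun v hv hv' => ?_, fun v hv hv' hφφ hv'' => ?_⟩
  · linarith [f1 v hv]
  · have : 0 ≤ ∑ u, f u v := Finset.sum_nonneg fun u _ => hf.1 u v
    unfold drift
    linarith [(f2 v hv hv').1]
  · have h1 : f (φ v) v ≤ ∑ u, f u v :=
      Finset.single_le_sum (f := fun u => f u v) (fun u _ => hf.1 u v) (Finset.mem_univ _)
    have h2 := (f2 _ (hφ v hv hv').1 hv'').2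
    rw [hφφ] at h2
    unfold drift
    linarith [(f2 v hv hv').1, H.le_rate (φ v)]

theorem exists_partner (r : V → V → Prop) (K : Finset V) :
    ∃ φ : V → V, ∀ v ∈ K, v ∉ isolated r K → φ v ∈ K ∧ r v (φ v) := by
  classical
  refine ⟨fun v => if h : ∃ u ∈ K, r v u then h.choose else v, fun v hv hv' => ?_⟩
  have h : ∃ u ∈ K, r v u := by
    by_contra! h
    exact hv' (mem_isolated.2 ⟨hv, h⟩)
  simpa only [dif_pos h] using h.choose_spec

theorem HasSlack.exists_flow_drift_le (H : HasSlack r blk α γ δ K) :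
    ∃ f ∈ flowSet r α K, ∀ v ∈ K, drift α f v ≤ δ := by
  classical
  obtain ⟨φ, hφ⟩ := exists_partner r K
  obtain ⟨f, hf, f1, f2, -⟩ := H.exists_flow hφ 0
    (fun _ _ _ _ => by simpa using add_nonneg H.pos.le H.nonneg) (by simp)
  refine ⟨f, hf, fun v hv => ?_⟩
  by_cases hv' : v ∈ isolated r K
  · simpa using f1 v hv'
  · exact (f2 v hv hv').trans H.nonneg

/-- Three mechanisms lower the drift of `k`. If it has a nonempty neighbour, the two consume each
other's stock; if its block is not entirely isolated, only proper-part slack is at stake and all of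
it can go to `k`; otherwise service is moved to `k` from a cheaper `m`. In the last case `m` may
grow, but the cost difference, at least `κ`, outweighs this once `δ` is small. -/
theorem HasSlack.exists_flow_drift_neg (H : HasSlack r blk α γ δ K) {c : V → ℝ} {κ C : ℝ}
    (hκ : ∀ v, κ ≤ c v) (hκ0 : 0 < κ) (hκ' : ∀ v u, c u < c v → κ ≤ c v - c u)
    (hC : ∀ v, c v ≤ C) (hδ : 4 * C * δ ≤ κ * γ) {k : V} (hk : k ∈ K) (hother : ∃ u ∈ K, u ≠ k)
    (h : (∃ v, blk v = blk k ∧ v ∉ isolated r K) ∨ ∃ m, blk m = blk k ∧ c m < c k) :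
    ∃ f ∈ flowSet r α K, ∃ m ∈ K, m ≠ k ∧ drift α f k ≤ -γ ∧
      c k * drift α f k + c m * drift α f m ≤ -(κ * γ / 2) ∧
      ∀ j ∈ K, j ≠ m → drift α f j ≤ δ := by
  classical
  have hγ := H.pos
  have hδ0 := H.nonneg
  have hc0 : ∀ v, 0 < c v := fun v => hκ0.trans_le (hκ v)
  have hcδ : ∀ v, c v * δ ≤ κ * γ / 4 := fun v => by
    have := mul_le_mul_of_nonneg_right (hC v) hδ0
    linarith
  have hkγ : κ * γ ≤ c k * γ := mul_le_mul_of_nonneg_right (hκ k) hγ.le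
  have hκγ : 0 < κ * γ := mul_pos hκ0 hγ
  have simple : ∀ f : V → V → ℝ, ∀ m, drift α f k ≤ -γ → drift α f m ≤ δ →
      c k * drift α f k + c m * drift α f m ≤ -(κ * γ / 2) := by
    intro f m h1 h2
    have h3 := mul_le_mul_of_nonneg_left h1 (hc0 k).le
    have h4 := mul_le_mul_of_nonneg_left h2 (hc0 m).le
    linarith [hcδ m]
  obtain ⟨φ, hφ⟩ := exists_partner r K
  obtain ⟨u, hu, huk⟩ := hother
  by_cases hkI : k ∈ isolated r K
  · by_cases hb : ∃ v, blk v = blk k ∧ v ∉ isolated r K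
    · obtain ⟨v₀, hv₀, hv₀I⟩ := hb
      -- No set of isolated buffers containing `k` is a full block, since `v₀` is missing from it;
      -- extra demand at `k` is therefore covered by the slack of proper parts.
      obtain ⟨f, hf, f1, f2, -⟩ := H.exists_flow hφ (fun v => if v = k then γ + δ else 0)
        (fun b T hT hb => by
          rw [Finset.sum_ite_eq']
          split_ifs <;> linarith)
        (fun b T hT hb hne => by
          have hkT : k ∉ T := fun hkT => hv₀I (hT ((hb v₀).2 (hv₀.trans ((hb k).1 hkT))))
          rw [Finset.sum_ite_eq', if_neg hkT])
      · have hk1 : drift α f k ≤ -γ := by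
          have := f1 k hkI
          simp only [if_true] at this
          linarith
        have hall : ∀ j ∈ K, drift α f j ≤ δ := by
          intro j hj
          by_cases hjI : j ∈ isolated r K
          · have := f1 j hjI
            split_ifs at this <;> linarith
          · linarith [f2 j hj hjI]
        exact ⟨f, hf, u, hu, huk, hk1, simple f u hk1 (hall u hu), fun j hj _ => hall j hj⟩
    · push Not at hb
      obtain ⟨v₀, hv₀, hv₀I⟩ | ⟨m, hmb, hcm⟩ := h
      · exact absurd (hb v₀ hv₀) hv₀I
      · have hkm : m ≠ k := by
          rintro rfl
          exact lt_irrefl _ hcm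
        have hmI := hb m hmb
        -- The perturbation has sum zero over the common block of `k` and `m`, so the constraint on
        -- full blocks is respected.
        obtain ⟨f, hf, f1, f2, -⟩ := H.exists_flow hφ
          (fun v => (if v = k then γ + δ else 0) - if v = m then γ + δ else 0)
          (fun b T hT hb => by
            rw [Finset.sum_sub_distrib, Finset.sum_ite_eq', Finset.sum_ite_eq']
            split_ifs <;> linarith)
          (fun b T hT hb hne => by
            rw [Finset.sum_sub_distrib, Finset.sum_ite_eq', Finset.sum_ite_eq']
            split_ifs with h1 h2
            · linarith
            · exact absurd ((hb m).2 (hmb.trans ((hb k).1 h1))) h2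
            · linarith
            · linarith)
        have hk1 : drift α f k ≤ -γ := by
          have := f1 k hkI
          rw [if_pos rfl, if_neg hkm.symm] at this
          linarith
        have hm1 : drift α f m ≤ γ + 2 * δ := by
          have := f1 m hmI
          rw [if_neg hkm, if_pos rfl] at this
          linarith
        -- The weighted drift is at most `-(c k - c m) γ + 2 c m δ`, where the first term is at most
        -- `-κ γ` and the second at most `κ γ / 2`.
        refine ⟨f, hf, m, (mem_isolated.1 hmI).1, hkm, hk1, ?_, fun j hj hjm => ?_⟩
        · have h3 := mul_le_mul_of_nonneg_left hk1 (hc0 k).le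
          have h4 := mul_le_mul_of_nonneg_left hm1 (hc0 m).le
          have h5 := mul_le_mul_of_nonneg_right (hκ' k m hcm) hγ.le
          linarith [hcδ m]
        · by_cases hjI : j ∈ isolated r K
          · have := f1 j hjI
            rw [if_neg hjm] at this
            split_ifs at this <;> linarith
          · linarith [f2 j hj hjI]
  · obtain ⟨hm, hkm⟩ := hφ k hk hkI
    set m := φ k with hm_def
    have hmI : m ∉ isolated r K := fun h' => (mem_isolated.1 h').2 k hk (H.symm _ _ hkm)
    have hkm' : k ≠ m := fun heq => H.irrefl k (by rwa [← heq] at hkm)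
    -- The partner of `m` is redefined to be `k`, which makes the pairing of `k` and `m` mutual.
    obtain ⟨f, hf, f1, f2, f3⟩ := H.exists_flow (φ := fun v => if v = m then k else φ v)
      (fun v hv hv' => by
        by_cases hvm : v = m
        · subst hvm; simpa using ⟨hk, H.symm _ _ hkm⟩
        · simpa [hvm] using hφ v hv hv') 0 (fun _ _ _ _ => by simpa using add_nonneg hγ.le hδ0) (by simp)
    have hall : ∀ j ∈ K, drift α f j ≤ δ := by
      intro j hj
      by_cases hjI : j ∈ isolated r K
      · simpa using f1 j hjI
      · exact (f2 j hj hjI).trans hδ0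
    have hk1 : drift α f k ≤ -γ := by
      refine f3 k hk hkI ?_ ?_
      · simp [hkm', ← hm_def]
      · simpa [hkm', ← hm_def] using hmI
    exact ⟨f, hf, m, hm, hkm'.symm, hk1, simple f m hk1 (hall m hm), fun j hj _ => hall j hj⟩

end Drift

/-! ### Cost of a state compared with the effective cost. -/

section Excess

variable {V : Type*} [Fintype V]

/-- The block that contains the neighbours of the members of the block `b`. -/
def opp (b : Bool × Bool) : Bool × Bool := (!b.1, b.2)

/-- The sum of `x` over a block. -/
def blockSum (blk : V → Bool × Bool) (x : V → ℝ) (b : Bool × Bool) : ℝ :=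
  ∑ v with blk v = b, x v

theorem sum_eq_blockSum (blk : V → Bool × Bool) (x : V → ℝ) :
    ∑ v, x v = (blockSum blk x (true, true) + blockSum blk x (false, true)) +
      (blockSum blk x (true, false) + blockSum blk x (false, false)) := by
  rw [← Finset.sum_fiberwise Finset.univ blk x, Fintype.sum_prod_type]
  simp only [Fintype.sum_bool, blockSum]
  ring

theorem blockSum_nonneg (blk : V → Bool × Bool) {x : V → ℝ} (hx : ∀ v, 0 ≤ x v)
    (b : Bool × Bool) : 0 ≤ blockSum blk x b :=
  Finset.sum_nonneg fun v _ => hx v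

theorem blockSum_le (blk : V → Bool × Bool) {x y : V → ℝ} (b : Bool × Bool)
    (h : ∀ v, blk v = b → x v ≤ y v) : blockSum blk x b ≤ blockSum blk y b :=
  Finset.sum_le_sum fun v hv => h v (Finset.mem_filter.1 hv).2

variable {r : V → V → Prop} {blk : V → Bool × Bool} {K : Finset V} {c q x : V → ℝ} {C qbar : ℝ}

/-- The block of `k` is isolated, so the opposite block is empty and the balance forces `x` to hold
at least as much as `q` in the block of `k`. Large buffers there all have the minimal cost `c k`;
the small ones contribute at most `C * qbar` each. -/
theorem blockSum_cost_le (hr : ∀ v u, r v u → r u v) (hnb : ∀ v, ∃ u, r v u)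
    (hopp : ∀ v u, r v u → blk u = opp (blk v)) (hc : ∀ v, 0 ≤ c v) (hC : ∀ v, c v ≤ C)
    (hq : ∀ v, 0 ≤ q v) (hx : ∀ v, 0 ≤ x v) (hK : ∀ v, v ∉ K → q v = 0) (hqbar : 0 ≤ qbar)
    {k : V} (hk : qbar ≤ q k)
    (hlarge : ∀ k, qbar ≤ q k → (∀ v, blk v = blk k → v ∈ isolated r K) ∧
      ∀ m, blk m = blk k → c k ≤ c m)
    (hbal : blockSum blk x (blk k) - blockSum blk x (opp (blk k))
      = blockSum blk q (blk k) - blockSum blk q (opp (blk k))) :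
    blockSum blk (fun v => c v * q v) (blk k) + blockSum blk (fun v => c v * q v) (opp (blk k)) ≤
      blockSum blk (fun v => c v * x v) (blk k) +
        blockSum blk (fun v => c v * x v) (opp (blk k)) +
        blockSum blk (fun _ => C * qbar) (blk k) := by
  obtain ⟨hI, hm⟩ := hlarge k hk
  have hzero : ∀ v, blk v = opp (blk k) → q v = 0 := by
    intro v hv
    refine hK v fun hvK => ?_
    obtain ⟨u, hu⟩ := hnb v
    have hb : blk u = blk k := by
      rw [hopp v u hu, hv]
      simp [opp]
    exact (mem_isolated.1 (hI u hb)).2 v hvK (hr _ _ hu)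
  have h1 : blockSum blk q (opp (blk k)) ≤ 0 :=
    Finset.sum_nonpos fun v hv => (hzero v (Finset.mem_filter.1 hv).2).le
  have h1' : blockSum blk (fun v => c v * q v) (opp (blk k)) ≤ 0 :=
    Finset.sum_nonpos fun v hv => by rw [hzero v (Finset.mem_filter.1 hv).2, mul_zero]
  have h2 := blockSum_nonneg blk hx (opp (blk k))
  have h2' := blockSum_nonneg blk (fun v => mul_nonneg (hc v) (hx v)) (opp (blk k))
  have h2'' := blockSum_nonneg blk hq (opp (blk k))
  have h3 : blockSum blk (fun v => c v * q v) (blk k) ≤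
      blockSum blk (fun v => c k * q v + C * qbar) (blk k) := by
    refine blockSum_le blk _ fun v hv => ?_
    have hcq : 0 ≤ c k * q v := mul_nonneg (hc k) (hq v)
    have hCq : 0 ≤ C * qbar := mul_nonneg ((hc k).trans (hC k)) hqbar
    rcases le_or_gt qbar (q v) with hl | hl
    -- Another large buffer of the block is also of minimal cost, hence no dearer than `k`.
    · have := (hlarge v hl).2 k hv.symm
      have := mul_le_mul_of_nonneg_right this (hq v)
      linarith
    · have := mul_le_mul (hC v) hl.le (hq v) ((hc k).trans (hC k))
      linarith
  have h4 : blockSum blk (fun v => c k * q v + C * qbar) (blk k) =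
      c k * blockSum blk q (blk k) + blockSum blk (fun _ => C * qbar) (blk k) := by
    rw [blockSum, Finset.sum_add_distrib, ← Finset.mul_sum]
    rfl
  have h5 : c k * blockSum blk x (blk k) ≤ blockSum blk (fun v => c v * x v) (blk k) := by
    rw [blockSum, Finset.mul_sum]
    exact blockSum_le blk _ fun v hv => mul_le_mul_of_nonneg_right (hm v hv) (hx v)
  have h6 : c k * blockSum blk q (blk k) ≤ c k * blockSum blk x (blk k) :=
    mul_le_mul_of_nonneg_left (by linarith) (hc k)
  linarith

/-- If each buffer with at least `qbar` units has minimal cost in its block, and the members of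
that block are nonempty but their neighbours empty, then the cost of `q` is nearly minimal. -/
theorem sum_cost_le (hr : ∀ v u, r v u → r u v) (hnb : ∀ v, ∃ u, r v u)
    (hopp : ∀ v u, r v u → blk u = opp (blk v)) (hc : ∀ v, 0 ≤ c v) (hC : ∀ v, c v ≤ C)
    (hq : ∀ v, 0 ≤ q v) (hx : ∀ v, 0 ≤ x v) (hK : ∀ v, v ∉ K → q v = 0) (hqbar : 0 ≤ qbar)
    (hC0 : 0 ≤ C)
    (hlarge : ∀ k, qbar ≤ q k → (∀ v, blk v = blk k → v ∈ isolated r K) ∧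
      ∀ m, blk m = blk k → c k ≤ c m)
    (hbal : ∀ t, blockSum blk x (true, t) - blockSum blk x (false, t)
      = blockSum blk q (true, t) - blockSum blk q (false, t)) :
    ∑ v, c v * q v ≤ ∑ v, c v * x v + Fintype.card V * (C * qbar) := by
  have key : ∀ t, blockSum blk (fun v => c v * q v) (true, t) +
      blockSum blk (fun v => c v * q v) (false, t) ≤
      blockSum blk (fun v => c v * x v) (true, t) + blockSum blk (fun v => c v * x v) (false, t) +
      (blockSum blk (fun _ => C * qbar) (true, t) + blockSum blk (fun _ => C * qbar) (false, t)) := by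
    intro t
    have n1 := blockSum_nonneg blk (fun _ => mul_nonneg hC0 hqbar) (true, t)
    have n2 := blockSum_nonneg blk (fun _ => mul_nonneg hC0 hqbar) (false, t)
    by_cases h1 : ∃ k, qbar ≤ q k ∧ blk k = (true, t)
    · obtain ⟨k, hk, hb⟩ := h1
      have := blockSum_cost_le hr hnb hopp hc hC hq hx hK hqbar hk hlarge
        (by rw [hb]; simpa [opp] using hbal t)
      rw [hb] at this
      simp only [opp, Bool.not_true] at this
      linarith
    by_cases h2 : ∃ k, qbar ≤ q k ∧ blk k = (false, t)
    · obtain ⟨k, hk, hb⟩ := h2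
      have := blockSum_cost_le hr hnb hopp hc hC hq hx hK hqbar hk hlarge
        (by rw [hb]; simp only [opp, Bool.not_false]; linarith [hbal t])
      rw [hb] at this
      simp only [opp, Bool.not_false] at this
      linarith
    push Not at h1 h2
    have small : ∀ b, (∀ k, qbar ≤ q k → blk k ≠ b) →
        blockSum blk (fun v => c v * q v) b ≤ blockSum blk (fun _ => C * qbar) b := by
      intro b hb
      refine blockSum_le blk b fun v hv => ?_
      have : q v < qbar := lt_of_not_ge fun h => hb v h hv
      exact mul_le_mul (hC v) this.le (hq v) hC0
    have n3 := blockSum_nonneg blk (fun v => mul_nonneg (hc v) (hx v)) (true, t)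
    have n4 := blockSum_nonneg blk (fun v => mul_nonneg (hc v) (hx v)) (false, t)
    linarith [small _ h1, small _ h2]
  have hcard : (Fintype.card V : ℝ) * (C * qbar) = ∑ _v : V, C * qbar := by
    simp
  rw [hcard, sum_eq_blockSum blk, sum_eq_blockSum blk fun v => c v * x v,
    sum_eq_blockSum blk fun _ => C * qbar]
  linarith [key true, key false]

end Excess

/-! ### Finitely supported laws. -/

section Policy

variable {Dm Sp : Type*} [Fintype Dm] [Fintype Sp] [DecidableEq Dm] [DecidableEq Sp]

/-- The expectation of a function under the image of a law on a finite type. -/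
theorem tsum_map_toReal_mul {O β : Type*} [Fintype O] (p : PMF O) (g : O → β) (F : β → ℝ) :
    ∑' n, (p.map g n).toReal * F n = ∑ o, (p o).toReal * F (g o) := by
  classical
  have h : ∀ n, (p.map g n).toReal * F n
      = ∑ o, if n = g o then (p o).toReal * F (g o) else 0 := by
    intro n
    rw [PMF.map_apply, tsum_fintype, ENNReal.toReal_sum fun o _ => by
      split_ifs
      exacts [p.apply_ne_top o, ENNReal.zero_ne_top], Finset.sum_mul]
    refine Finset.sum_congr rfl fun o _ => ?_
    split_ifs with h
    · rw [h]
    · simp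
  simp_rw [h]
  rw [Summable.tsum_finsetSum fun o _ => (hasSum_ite_eq (g o) _).summable]
  refine Finset.sum_congr rfl fun o _ => tsum_ite_eq _ _

/-- A probability law on a finite type with real weights. -/
def pmfOfReal {O : Type*} [Fintype O] (w : O → ℝ) (h0 : ∀ o, 0 ≤ w o) (h1 : ∑ o, w o = 1) :
    PMF O :=
  PMF.ofFintype (fun o => ENNReal.ofReal (w o)) (by
    rw [← ENNReal.ofReal_sum_of_nonneg fun o _ => h0 o, h1, ENNReal.ofReal_one])

theorem toReal_pmfOfReal {O : Type*} [Fintype O] (w : O → ℝ) (h0 : ∀ o, 0 ≤ w o)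
    (h1 : ∑ o, w o = 1) (o : O) : (pmfOfReal w h0 h1 o).toReal = w o := by
  simp [pmfOfReal, h0 o]

theorem pos_of_mem_support_pmfOfReal {O : Type*} [Fintype O] {w : O → ℝ} {h0 : ∀ o, 0 ≤ w o}
    {h1 : ∑ o, w o = 1} {o : O} (h : o ∈ (pmfOfReal w h0 h1).support) : 0 < w o := by
  simpa [pmfOfReal, PMF.mem_support_iff] using h

end Policy

/-! ### Realising a flow by a randomized matching rule. -/

section Law

variable {Dm Sp : Type*} [Fintype Dm] [Fintype Sp] [DecidableEq Dm] [DecidableEq Sp]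

/-- Two classes are joined if they can be matched and the match is not a cross-match. -/
def Model.noncross {Dm Sp : Type*} (M : Model Dm Sp) (D : Set Dm) : Dm ⊕ Sp → Dm ⊕ Sp → Prop
  | Sum.inl i, Sum.inr j => (i, j) ∈ M.edges ∧ (i ∈ D ↔ j ∈ M.supplyOf D)
  | Sum.inr j, Sum.inl i => (i, j) ∈ M.edges ∧ (i ∈ D ↔ j ∈ M.supplyOf D)
  | _, _ => False

/-- The match of a unit of class `v` with a unit of the given other class. -/
def partnerMatch : Dm ⊕ Sp → Option (Dm ⊕ Sp) → Dm × Sp → ℕ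
  | Sum.inl i, some (Sum.inr j) => Pi.single (i, j) 1
  | Sum.inr j, some (Sum.inl i) => Pi.single (i, j) 1
  | _, _ => 0

theorem inputVec_add (n n' : Dm × Sp → ℕ) : inputVec (n + n') = inputVec n + inputVec n' := by
  ext k
  simp [inputVec, add_mul, Finset.sum_add_distrib]

theorem inputVec_zero : inputVec (0 : Dm × Sp → ℕ) = 0 := by
  ext k
  simp [inputVec]

theorem inputVec_single (e : Dm × Sp) : inputVec (Pi.single e 1) = pairVec e := by
  ext k
  simp [inputVec, Pi.single_apply]

omit [Fintype Dm] [Fintype Sp] in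
theorem pairVec_eq (e : Dm × Sp) (k : Dm ⊕ Sp) :
    pairVec e k = (if k = Sum.inl e.1 then 1 else 0) + if k = Sum.inr e.2 then 1 else 0 := by
  cases k <;> simp [pairVec]

theorem inputVec_partnerMatch {M : Model Dm Sp} {D : Set Dm} {v u : Dm ⊕ Sp}
    (h : M.noncross D v u) (k : Dm ⊕ Sp) :
    inputVec (partnerMatch v (some u)) k = (if k = v then 1 else 0) + if k = u then 1 else 0 := by
  rcases v with i | j <;> rcases u with i' | j'
  · exact h.elim
  · simp only [partnerMatch, inputVec_single, pairVec_eq]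
  · simp only [partnerMatch, inputVec_single, pairVec_eq]
    exact add_comm _ _
  · exact h.elim

theorem sum_partnerMatch_le (v : Dm ⊕ Sp) (o : Option (Dm ⊕ Sp)) :
    ∑ e, partnerMatch v o e ≤ 1 := by
  rcases v with i | j <;> rcases o with _ | i' | j' <;> simp [partnerMatch]

omit [Fintype Dm] [Fintype Sp] in
theorem partnerMatch_eq_zero {M : Model Dm Sp} {D : Set Dm} {v u : Dm ⊕ Sp}
    (h : M.noncross D v u) {i : Dm} {j : Sp}
    (hij : ¬ ((i, j) ∈ M.edges ∧ (i ∈ D ↔ j ∈ M.supplyOf D))) :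
    partnerMatch v (some u) (i, j) = 0 := by
  rcases v with a | a <;> rcases u with b | b
  · exact h.elim
  · simp only [partnerMatch, Pi.single_apply]
    rw [if_neg]
    rintro ⟨rfl, rfl⟩
    exact hij h
  · simp only [partnerMatch, Pi.single_apply]
    rw [if_neg]
    rintro ⟨rfl, rfl⟩
    exact hij h
  · exact h.elim

/-- The real number `h ⬝ U` for the input `U` given by `n`. -/
def inputDot (h : Dm ⊕ Sp → ℝ) (n : Dm × Sp → ℕ) : ℝ := ∑ k, h k * (inputVec n k : ℝ)

theorem inputDot_add (h : Dm ⊕ Sp → ℝ) (n n' : Dm × Sp → ℕ) :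
    inputDot h (n + n') = inputDot h n + inputDot h n' := by
  simp [inputDot, inputVec_add, mul_add, Finset.sum_add_distrib]

theorem inputDot_single (h : Dm ⊕ Sp → ℝ) (e : Dm × Sp) :
    inputDot h (Pi.single e 1) = h (Sum.inl e.1) + h (Sum.inr e.2) := by
  simp [inputDot, inputVec_single, pairVec_eq, mul_add, Finset.sum_add_distrib]

theorem inputDot_partnerMatch_none (h : Dm ⊕ Sp → ℝ) (v : Dm ⊕ Sp) :
    inputDot h (partnerMatch v none) = 0 := by
  have : partnerMatch v none = 0 := by cases v <;> rfl
  simp [this, inputDot, inputVec_zero]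

theorem inputDot_partnerMatch {M : Model Dm Sp} {D : Set Dm} {v u : Dm ⊕ Sp}
    (hr : M.noncross D v u) (h : Dm ⊕ Sp → ℝ) :
    inputDot h (partnerMatch v (some u)) = h v + h u := by
  simp [inputDot, inputVec_partnerMatch hr, mul_add, Finset.sum_add_distrib]

/-- The rates of the classes, if the pairs have the weights `p`. -/
def marginal (p : Dm × Sp → ℝ) (k : Dm ⊕ Sp) : ℝ := ∑ a, p a * (pairVec a k : ℝ)

theorem sum_marginal_mul (p : Dm × Sp → ℝ) (R : Dm ⊕ Sp → ℝ) :
    ∑ v, marginal p v * R v = ∑ a, p a * (R (Sum.inl a.1) + R (Sum.inr a.2)) := by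
  simp only [marginal, Finset.sum_mul]
  rw [Finset.sum_comm]
  refine Finset.sum_congr rfl fun a _ => ?_
  simp only [mul_assoc, ← Finset.mul_sum]
  simp [pairVec_eq, add_mul, Finset.sum_add_distrib]

/-- The law of the partner of an arriving unit of class `v`. -/
def partnerWeight (α : Dm ⊕ Sp → ℝ) (f : Dm ⊕ Sp → Dm ⊕ Sp → ℝ) (v : Dm ⊕ Sp) :
    Option (Dm ⊕ Sp) → ℝ
  | none => 1 - ∑ u, f v u / α v
  | some u => f v u / α v

omit [DecidableEq Dm] [DecidableEq Sp] in
theorem sum_partnerWeight (α : Dm ⊕ Sp → ℝ) (f : Dm ⊕ Sp → Dm ⊕ Sp → ℝ) (v : Dm ⊕ Sp) :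
    ∑ o, partnerWeight α f v o = 1 := by
  simp [Fintype.sum_option, partnerWeight]

variable {M : Model Dm Sp} {D : Set Dm} {K : Finset (Dm ⊕ Sp)} {α : Dm ⊕ Sp → ℝ}
  {f : Dm ⊕ Sp → Dm ⊕ Sp → ℝ}

omit [DecidableEq Dm] [DecidableEq Sp] in
theorem partnerWeight_nonneg (hα : ∀ v, 0 ≤ α v) (hf : f ∈ flowSet (M.noncross D) α K)
    (v : Dm ⊕ Sp) (o : Option (Dm ⊕ Sp)) : 0 ≤ partnerWeight α f v o := by
  cases o with
  | none =>
    rw [partnerWeight, ← Finset.sum_div, sub_nonneg]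
    exact div_le_one_of_le₀ (hf.2.2 v) (hα v)
  | some u => exact div_nonneg (hf.1 v u) (hα v)

theorem rate_mul_sum_partnerWeight (hf : f ∈ flowSet (M.noncross D) α K) (h : Dm ⊕ Sp → ℝ)
    (v : Dm ⊕ Sp) :
    α v * ∑ o, partnerWeight α f v o * inputDot h (partnerMatch v o)
      = ∑ u, f v u * (h v + h u) := by
  rw [Fintype.sum_option, inputDot_partnerMatch_none, mul_zero, zero_add, Finset.mul_sum]
  refine Finset.sum_congr rfl fun u _ => ?_
  by_cases hvu : M.noncross D v u ∧ u ∈ K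
  · rw [inputDot_partnerMatch hvu.1, partnerWeight]
    -- A class with rate zero has no outflow, so the convention for division by zero is harmless.
    by_cases h0 : α v = 0
    · have hs := hf.2.2 v
      have : f v u ≤ ∑ u, f v u :=
        Finset.single_le_sum (fun u _ => hf.1 v u) (Finset.mem_univ u)
      have : f v u = 0 := le_antisymm (by linarith) (hf.1 v u)
      simp [this]
    · field_simp
  · simp [partnerWeight, hf.2.1 v u hvu]

/-- The law of the matching activities at a fixed vector `q`, with the arrival `a`: with
probability `θ a` only the arriving pair is matched; otherwise each of the two arriving units is
matched with a unit in a random nonempty buffer or not at all. -/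
def arrivalWeight (θ : Dm × Sp → ℝ) (α : Dm ⊕ Sp → ℝ) (f : Dm ⊕ Sp → Dm ⊕ Sp → ℝ)
    (a : Dm × Sp) : Option (Option (Dm ⊕ Sp) × Option (Dm ⊕ Sp)) → ℝ
  | none => θ a
  | some o => (1 - θ a) *
      (partnerWeight α f (Sum.inl a.1) o.1 * partnerWeight α f (Sum.inr a.2) o.2)

/-- The matching activities that belong to an outcome under `arrivalWeight`. -/
def arrivalMatch (a : Dm × Sp) : Option (Option (Dm ⊕ Sp) × Option (Dm ⊕ Sp)) → Dm × Sp → ℕ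
  | none => Pi.single a 1
  | some o => partnerMatch (Sum.inl a.1) o.1 + partnerMatch (Sum.inr a.2) o.2

/-- The two partners are drawn independently and `h ⬝ U` is additive in the two matches, so the mean
splits into one term per arriving unit. -/
theorem sum_arrivalWeight_mul (θ : Dm × Sp → ℝ) (a : Dm × Sp) (c : ℝ) (h : Dm ⊕ Sp → ℝ) :
    ∑ o, arrivalWeight θ α f a o * (c + inputDot h (arrivalMatch a o)) =
      c + θ a * (h (Sum.inl a.1) + h (Sum.inr a.2)) + (1 - θ a) *
        (∑ o, partnerWeight α f (Sum.inl a.1) o * inputDot h (partnerMatch (Sum.inl a.1) o) +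
          ∑ o, partnerWeight α f (Sum.inr a.2) o *
            inputDot h (partnerMatch (Sum.inr a.2) o)) := by
  rw [Fintype.sum_option, Fintype.sum_prod_type]
  simp only [arrivalWeight, arrivalMatch, inputDot_add, inputDot_single]
  set π := partnerWeight α f (Sum.inl a.1)
  set π' := partnerWeight α f (Sum.inr a.2)
  set F := fun o => inputDot h (partnerMatch (Sum.inl a.1) o)
  set F' := fun o => inputDot h (partnerMatch (Sum.inr a.2) o)
  have e1 : ∑ x, π x = 1 := sum_partnerWeight _ _ _
  have e2 : ∑ x, π' x = 1 := sum_partnerWeight _ _ _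
  have e3 : ∀ x, ∑ y, (1 - θ a) * (π x * π' y) * (c + (F x + F' y)) =
      (1 - θ a) * (π x * (c + F x + ∑ y, π' y * F' y)) := by
    intro x
    have : ∀ y, (1 - θ a) * (π x * π' y) * (c + (F x + F' y)) =
        (1 - θ a) * π x * (c + F x) * π' y + (1 - θ a) * π x * (π' y * F' y) := by
      intro y; ring
    simp only [this, Finset.sum_add_distrib, ← Finset.mul_sum, e2]
    ring
  have e4 : ∑ x, (1 - θ a) * (π x * (c + F x + ∑ y, π' y * F' y)) =
      (1 - θ a) * (c + ∑ x, π x * F x + ∑ y, π' y * F' y) := by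
    have : ∀ x, (1 - θ a) * (π x * (c + F x + ∑ y, π' y * F' y)) =
        (1 - θ a) * (c + ∑ y, π' y * F' y) * π x + (1 - θ a) * (π x * F x) := by
      intro x; ring
    simp only [this, Finset.sum_add_distrib, ← Finset.mul_sum, e1]
    ring
  rw [Finset.sum_congr rfl fun x _ => e3 x, e4]
  ring

/-- When the arriving pair is not matched with itself, a unit of class `v` picks the partner `u`
with probability `f v u / α v`, where `α` counts only such arrivals; averaging over the arrival
cancels `α v`. At most two matches are made. The conclusion covers all functionals affine in `U`,
which is the form of every conditional mean required later. -/
theorem exists_law (hmax : 4 ≤ M.maxMatches) {p θ : Dm × Sp → ℝ} (hp : ∀ a, 0 ≤ p a)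
    (hθ : ∀ a, θ a ∈ Icc (0 : ℝ) 1) (hθe : ∀ a, θ a ≠ 0 → a ∈ M.edges) {q : Dm ⊕ Sp → ℕ}
    (hK : ∀ v ∈ K, 1 ≤ q v)
    (hf : f ∈ flowSet (M.noncross D) (marginal fun a => p a * (1 - θ a)) K) :
    ∃ law : Dm × Sp → PMF (Dm × Sp → ℕ),
      (∀ a, ∀ n ∈ (law a).support, M.IsFeasible (q + pairVec a) n) ∧
      (∀ a, θ a = 0 → ∀ n ∈ (law a).support, ∀ i j, i ∉ D → j ∈ M.supplyOf D → n (i, j) = 0) ∧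
      ∀ (G : Dm × Sp → ℝ) (h : Dm ⊕ Sp → ℝ),
        ∑ a, p a * ∑' n, (law a n).toReal * (G a + inputDot h n) =
          ∑ a, p a * G a + ∑ k, h k * (marginal (fun a => p a * θ a) k +
            (∑ u, f k u + ∑ u, f u k)) := by
  set α := marginal fun a => p a * (1 - θ a) with hα_def
  have hα : ∀ v, 0 ≤ α v := fun v => Finset.sum_nonneg fun a _ =>
    mul_nonneg (mul_nonneg (hp a) (sub_nonneg.2 (hθ a).2)) (Nat.cast_nonneg _)
  have hw0 : ∀ a o, 0 ≤ arrivalWeight θ α f a o := by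
    rintro a (_ | o)
    · exact (hθ a).1
    · exact mul_nonneg (sub_nonneg.2 (hθ a).2)
        (mul_nonneg (partnerWeight_nonneg hα hf _ _) (partnerWeight_nonneg hα hf _ _))
  have hw1 : ∀ a, ∑ o, arrivalWeight θ α f a o = 1 := by
    intro a
    simpa [inputDot] using sum_arrivalWeight_mul (α := α) (f := f) θ a 1 0
  have hout : ∀ v o, partnerWeight α f v o ≠ 0 →
      o = none ∨ ∃ u, o = some u ∧ M.noncross D v u ∧ u ∈ K := by
    rintro v (_ | u) ho
    · exact Or.inl rfl
    · refine Or.inr ⟨u, rfl, ?_⟩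
      by_contra hcon
      exact ho (by simp [partnerWeight, hf.2.1 v u hcon])
  have hnone : ∀ v : Dm ⊕ Sp, partnerMatch v none = 0 := by
    intro v; cases v <;> rfl
  have hpm : ∀ v o, partnerWeight α f v o ≠ 0 → ∀ i j,
      ¬ ((i, j) ∈ M.edges ∧ (i ∈ D ↔ j ∈ M.supplyOf D)) → partnerMatch v o (i, j) = 0 := by
    intro v o ho i j hij
    obtain rfl | ⟨u, rfl, hu, -⟩ := hout v o ho
    · rw [hnone]; rfl
    · exact partnerMatch_eq_zero hu hij
  have hcase : ∀ a, ∀ n ∈ ((pmfOfReal _ (hw0 a) (hw1 a)).map (arrivalMatch a)).support,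
      (θ a ≠ 0 ∧ n = Pi.single a 1) ∨ ∃ x y, partnerWeight α f (Sum.inl a.1) x ≠ 0 ∧
        partnerWeight α f (Sum.inr a.2) y ≠ 0 ∧
        n = partnerMatch (Sum.inl a.1) x + partnerMatch (Sum.inr a.2) y := by
    intro a n hn
    rw [PMF.support_map] at hn
    obtain ⟨o, ho, rfl⟩ := hn
    have hpos := (pos_of_mem_support_pmfOfReal ho).ne'
    cases o with
    | none => exact Or.inl ⟨hpos, rfl⟩
    | some o =>
      have := right_ne_zero_of_mul hpos
      exact Or.inr ⟨o.1, o.2, left_ne_zero_of_mul this, right_ne_zero_of_mul this, rfl⟩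
  refine ⟨fun a => (pmfOfReal _ (hw0 a) (hw1 a)).map (arrivalMatch a), ?_, ?_, ?_⟩
  · intro a n hn
    obtain ⟨hθa, rfl⟩ | ⟨x, y, hx, hy, rfl⟩ := hcase a n hn
    · refine ⟨fun e he => ?_, ?_, fun k => ?_⟩
      · rw [Pi.single_apply, if_neg]
        rintro rfl
        exact he (hθe _ hθa)
      · simp only [Finset.sum_pi_single', Finset.mem_univ, if_true]
        omega
      · rw [inputVec_single]
        exact Nat.le_add_left _ _
    · refine ⟨fun e he => ?_, ?_, fun k => ?_⟩
      · rw [Pi.add_apply, hpm _ _ hx e.1 e.2 fun h => he h.1, hpm _ _ hy e.1 e.2 fun h => he h.1]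
      · simp only [Pi.add_apply, Finset.sum_add_distrib]
        have := sum_partnerMatch_le (Sum.inl a.1) x
        have := sum_partnerMatch_le (Sum.inr a.2) y
        omega
      · rw [inputVec_add, Pi.add_apply, Pi.add_apply, pairVec_eq]
        obtain rfl | ⟨u, rfl, hu, huK⟩ := hout _ x hx <;>
          obtain rfl | ⟨u', rfl, hu', huK'⟩ := hout _ y hy
        · simp [hnone, inputVec_zero]
        · rw [hnone, inputVec_zero, inputVec_partnerMatch hu']
          have := hK u' huK'
          by_cases hk : k = u'
          · subst hk; simp only [Pi.zero_apply]; split_ifs <;> omega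
          · simp only [if_neg hk, Pi.zero_apply]; split_ifs <;> omega
        · rw [hnone, inputVec_zero, inputVec_partnerMatch hu]
          have := hK u huK
          by_cases hk : k = u
          · subst hk; simp only [Pi.zero_apply]; split_ifs <;> omega
          · simp only [if_neg hk, Pi.zero_apply]; split_ifs <;> omega
        · rw [inputVec_partnerMatch hu, inputVec_partnerMatch hu']
          have h1 := hK u huK
          have h2 := hK u' huK'
          -- The partners of a demand unit and of a supply unit lie on opposite sides, so no buffer
          -- gives up two stored units and one stored unit in each suffices.
          have hne : u ≠ u' := by
            rcases u with i | j
            · exact hu.elim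
            rcases u' with i | j
            · simp
            · exact hu'.elim
          by_cases hk : k = u
          · subst hk; simp only [if_neg hne]; split_ifs <;> omega
          · by_cases hk' : k = u'
            · subst hk'; simp only [if_neg hk]; split_ifs <;> omega
            · simp only [if_neg hk, if_neg hk']; split_ifs <;> omega
  · intro a hθa n hn i j hi hj
    obtain ⟨hθa', -⟩ | ⟨x, y, hx, hy, rfl⟩ := hcase a n hn
    · exact absurd hθa hθa'
    · rw [Pi.add_apply, hpm _ _ hx i j fun h => hi (h.2.2 hj),
        hpm _ _ hy i j fun h => hi (h.2.2 hj)]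
  · intro G h
    have e1 : ∀ a, p a * ∑' n,
        (((pmfOfReal _ (hw0 a) (hw1 a)).map (arrivalMatch a)) n).toReal * (G a + inputDot h n) =
        p a * G a + p a * θ a * (h (Sum.inl a.1) + h (Sum.inr a.2)) + p a * (1 - θ a) *
        (∑ o, partnerWeight α f (Sum.inl a.1) o * inputDot h (partnerMatch (Sum.inl a.1) o) +
          ∑ o, partnerWeight α f (Sum.inr a.2) o *
            inputDot h (partnerMatch (Sum.inr a.2) o)) := by
      intro a
      rw [tsum_map_toReal_mul]
      simp only [toReal_pmfOfReal]
      rw [sum_arrivalWeight_mul]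
      ring
    have e2 := sum_marginal_mul (fun a => p a * (1 - θ a)) fun v =>
      ∑ o, partnerWeight α f v o * inputDot h (partnerMatch v o)
    have e3 := sum_marginal_mul (fun a => p a * θ a) h
    rw [Finset.sum_congr rfl fun a _ => e1 a, Finset.sum_add_distrib, Finset.sum_add_distrib,
      ← e2, ← e3, ← hα_def, Finset.sum_congr rfl fun v _ => rate_mul_sum_partnerWeight hf h v]
    have e4 : ∑ v, ∑ u, f v u * (h v + h u) = ∑ k, h k * (∑ u, f k u + ∑ u, f u k) := by
      simp only [mul_add, Finset.sum_add_distrib, Finset.mul_sum]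
      congr 1
      · simp only [mul_comm]
      · rw [Finset.sum_comm]
        simp only [mul_comm]
    rw [e4, add_assoc, ← Finset.sum_add_distrib]
    congr 1
    refine Finset.sum_congr rfl fun k _ => ?_
    ring

end Law

/-! ### Hall slack derived from the workload conditions. -/

section Blocks

variable {Dm Sp : Type*} {M : Model Dm Sp} {D : Set Dm}

open Classical in
/-- The block of a class: its side, and whether it belongs to `D` or `𝒮(D)`. -/
def Model.block (M : Model Dm Sp) (D : Set Dm) : Dm ⊕ Sp → Bool × Bool
  | Sum.inl i => (true, decide (i ∈ D))
  | Sum.inr j => (false, decide (j ∈ M.supplyOf D))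

theorem noncross_symm (v u : Dm ⊕ Sp) (h : M.noncross D v u) : M.noncross D u v := by
  cases v <;> cases u <;> exact h

theorem noncross_irrefl (v : Dm ⊕ Sp) : ¬ M.noncross D v v := by
  cases v <;> exact id

theorem block_of_noncross (v u : Dm ⊕ Sp) (h : M.noncross D v u) :
    M.block D u = opp (M.block D v) := by
  rcases v with i | j <;> rcases u with i' | j'
  · exact h.elim
  · simp [Model.block, opp, h.2]
  · simp [Model.block, opp, h.2]
  · exact h.elim

theorem xi_add_xi_of_noncross {v u : Dm ⊕ Sp} (h : M.noncross D v u) :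
    M.xi D v + M.xi D u = 0 := by
  classical
  rcases v with i | j <;> rcases u with i' | j'
  · exact h.elim
  · have := h.2
    by_cases hi : i ∈ D <;> simp_all [Model.xi]
  · have := h.2
    by_cases hi : i' ∈ D <;> simp_all [Model.xi]
  · exact h.elim

variable [Fintype Dm] [Fintype Sp]

theorem dot_xi (x : Dm ⊕ Sp → ℝ) : dot (M.xi D) x =
    blockSum (M.block D) x (true, true) - blockSum (M.block D) x (false, true) := by
  classical
  simp only [dot, blockSum, Finset.sum_filter, ← Finset.sum_sub_distrib]
  refine Finset.sum_congr rfl fun v _ => ?_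
  rcases v with i | j
  · by_cases hi : i ∈ D <;> simp [Model.xi, Model.block, hi]
  · by_cases hj : j ∈ M.supplyOf D <;> simp [Model.xi, Model.block, hj]

theorem dot_xi0 (D : Set Dm) (x : Dm ⊕ Sp → ℝ) : dot xi0 x =
    (blockSum (M.block D) x (true, true) - blockSum (M.block D) x (false, true)) +
      (blockSum (M.block D) x (true, false) - blockSum (M.block D) x (false, false)) := by
  classical
  simp only [dot, blockSum, Finset.sum_filter, ← Finset.sum_sub_distrib, ← Finset.sum_add_distrib]
  refine Finset.sum_congr rfl fun v _ => ?_
  rcases v with i | j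
  · by_cases hi : i ∈ D <;> simp [xi0, Model.block, hi]
  · by_cases hj : j ∈ M.supplyOf D <;> simp [xi0, Model.block, hj]

/-- For demand classes inside `D` every match is a noncross one, so the neighbours of `T` are all of
`𝒮(T)`; Hall's condition is then a workload condition. -/
theorem sum_sub_sum_nbr_of_mem {T : Finset (Dm ⊕ Sp)} (hT : ∀ v ∈ T, M.block D v = (true, true))
    (α : Dm ⊕ Sp → ℝ) :
    ∑ v ∈ T, α v - ∑ v ∈ nbr (M.noncross D) T, α v = dot (M.xi {i | Sum.inl i ∈ T}) α := by
  classical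
  rw [← Finset.univ_inter T, ← Finset.sum_ite_mem,
    ← Finset.univ_inter (nbr _ _), ← Finset.sum_ite_mem, ← Finset.sum_sub_distrib, dot]
  rw [Finset.univ_inter]
  refine Finset.sum_congr rfl fun v _ => ?_
  rcases v with i | j
  · have : Sum.inl i ∉ nbr (M.noncross D) T := by
      rw [mem_nbr]
      rintro ⟨i' | j, hu, hr⟩
      · exact hr
      · simpa [Model.block] using hT _ hu
    by_cases hi : Sum.inl i ∈ T <;> simp [Model.xi, this, hi]
  · have h1 : Sum.inr j ∉ T := fun h => by simpa [Model.block] using hT _ h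
    have h2 : Sum.inr j ∈ nbr (M.noncross D) T ↔ j ∈ M.supplyOf {i | Sum.inl i ∈ T} := by
      rw [mem_nbr]
      constructor
      · rintro ⟨i | j', hu, hr⟩
        · exact ⟨i, hu, hr.1⟩
        · exact hr.elim
      · rintro ⟨i, hi, he⟩
        have hiD : i ∈ D := by simpa [Model.block] using hT _ hi
        exact ⟨Sum.inl i, hi, he, fun _ => ⟨i, hiD, he⟩, fun _ => hiD⟩
    by_cases hj : Sum.inr j ∈ nbr (M.noncross D) T <;> simp [Model.xi, h1, hj, ← h2]

/-- Outside `D` the noncross neighbours of `T` are `𝒮(T ∪ D) \ 𝒮(D)`, hence a difference of two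
workloads. -/
theorem sum_sub_sum_nbr_of_notMem {T : Finset (Dm ⊕ Sp)}
    (hT : ∀ v ∈ T, M.block D v = (true, false)) (α : Dm ⊕ Sp → ℝ) :
    ∑ v ∈ T, α v - ∑ v ∈ nbr (M.noncross D) T, α v =
      dot (M.xi ({i | Sum.inl i ∈ T} ∪ D)) α - dot (M.xi D) α := by
  classical
  rw [← Finset.univ_inter T, ← Finset.sum_ite_mem,
    ← Finset.univ_inter (nbr _ _), ← Finset.sum_ite_mem, ← Finset.sum_sub_distrib, dot, dot,
    ← Finset.sum_sub_distrib]
  rw [Finset.univ_inter]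
  refine Finset.sum_congr rfl fun v _ => ?_
  have hTD : ∀ i, Sum.inl i ∈ T → i ∉ D := fun i hi => by simpa [Model.block] using hT _ hi
  rcases v with i | j
  · have : Sum.inl i ∉ nbr (M.noncross D) T := by
      rw [mem_nbr]
      rintro ⟨i' | j, hu, hr⟩
      · exact hr
      · simpa [Model.block] using hT _ hu
    have := hTD i
    by_cases hi : Sum.inl i ∈ T <;> by_cases hiD : i ∈ D <;> simp_all [Model.xi]
  · have h1 : Sum.inr j ∉ T := fun h => by simpa [Model.block] using hT _ h
    have h2 : Sum.inr j ∈ nbr (M.noncross D) T ↔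
        j ∈ M.supplyOf ({i | Sum.inl i ∈ T} ∪ D) ∧ j ∉ M.supplyOf D := by
      rw [mem_nbr]
      constructor
      · rintro ⟨i | j', hu, hr⟩
        · exact ⟨⟨i, Or.inl hu, hr.1⟩, fun h => hTD i hu (hr.2.2 h)⟩
        · exact hr.elim
      · rintro ⟨⟨i, hi | hi, he⟩, hjD⟩
        · exact ⟨Sum.inl i, hi, he, fun h => absurd h (hTD i hi), fun h => absurd h hjD⟩
        · exact absurd ⟨i, hi, he⟩ hjD
    have h3 : j ∈ M.supplyOf D → j ∈ M.supplyOf ({i | Sum.inl i ∈ T} ∪ D) := by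
      rintro ⟨i, hi, he⟩
      exact ⟨i, Or.inr hi, he⟩
    by_cases hj : j ∈ M.supplyOf D <;>
      by_cases hj' : j ∈ M.supplyOf ({i | Sum.inl i ∈ T} ∪ D) <;> simp_all [Model.xi]

/-- The properties of the rates `α` behind the drift bounds: complete resource pooling with a gap
`g`, except for the workload `δ` in the direction `D`. -/
structure HasGap (M : Model Dm Sp) (D : Set Dm) (α : Dm ⊕ Sp → ℝ) (g δ : ℝ) : Prop where
  left : ∀ i, ∃ j, (i, j) ∈ M.edges
  right : ∀ j, ∃ i, (i, j) ∈ M.edges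
  ne_univ : D ≠ univ
  gap : ∀ D' : Set Dm, D'.Nonempty → D' ≠ univ → D' ≠ D → dot (M.xi D') α ≤ -g
  balance : dot xi0 α = 0
  workload : dot (M.xi D) α = -δ
  le_rate : ∀ k, g ≤ α k
  nonneg : 0 ≤ δ
  lt : δ < g

variable {α : Dm ⊕ Sp → ℝ} {g δ : ℝ}

/-- Only a demand class `i ∉ D` needs the rates. If all its neighbours were in `𝒮(D)`, adjoining `i`
to `D` would raise the workload rate from `-δ` to `α i - δ > 0`, against the gap, or against the
balance if the enlarged set is everything. -/
theorem HasGap.exists_noncross (H : HasGap M D α g δ) (v : Dm ⊕ Sp) : ∃ u, M.noncross D v u := by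
  classical
  rcases v with i | j
  · by_cases hi : i ∈ D
    · obtain ⟨j, hj⟩ := H.left i
      exact ⟨Sum.inr j, hj, fun _ => ⟨i, hi, hj⟩, fun _ => hi⟩
    · by_contra! hcon
      have hall : ∀ j, (i, j) ∈ M.edges → j ∈ M.supplyOf D := by
        intro j hj
        by_contra hjD
        exact hcon (Sum.inr j) ⟨hj, fun h => absurd h hi, fun h => absurd h hjD⟩
      have hnbr : nbr (M.noncross D) {Sum.inl i} = ∅ := by
        ext v
        rw [mem_nbr]
        simp only [Finset.mem_singleton, exists_eq_left, Finset.notMem_empty, iff_false]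
        exact fun h => hcon v (noncross_symm _ _ h)
      have key := sum_sub_sum_nbr_of_notMem (M := M) (D := D) (T := {Sum.inl i})
        (by simp [Model.block, hi]) α
      rw [hnbr, Finset.sum_singleton, Finset.sum_empty, H.workload] at key
      have hle := H.le_rate (Sum.inl i)
      by_cases hu : ({i' | Sum.inl i' ∈ ({Sum.inl i} : Finset (Dm ⊕ Sp))} ∪ D) = univ
      · rw [hu] at key
        have : M.xi univ = xi0 := by
          ext v
          rcases v with i | j
          · simp [Model.xi, xi0]
          · have : j ∈ M.supplyOf univ := by
              obtain ⟨i, hi⟩ := H.right j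
              exact ⟨i, mem_univ _, hi⟩
            simp [Model.xi, xi0, this]
        rw [this, H.balance] at key
        linarith [H.lt]
      · have := H.gap _ ⟨i, by simp⟩ hu fun h => hi (by rw [← h]; simp)
        linarith [H.lt, H.nonneg]
  · by_cases hj : j ∈ M.supplyOf D
    · obtain ⟨i, hi, he⟩ := id hj
      exact ⟨Sum.inl i, he, fun _ => hj, fun _ => hi⟩
    · obtain ⟨i, he⟩ := H.right j
      exact ⟨Sum.inl i, he, fun hi => ⟨i, hi, he⟩, fun h => absurd h hj⟩

theorem HasGap.blockSum_sub (H : HasGap M D α g δ) (t : Bool) :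
    blockSum (M.block D) α (true, t) - blockSum (M.block D) α (false, t) =
      if t then -δ else δ := by
  have h1 := H.workload
  have h2 := H.balance
  rw [dot_xi] at h1
  rw [dot_xi0 (M := M) D] at h2
  cases t
  · simp only [Bool.false_eq_true, if_false]; linarith
  · simpa using h1

/-- The gap is applied to `T` itself inside `D`, and to `T ∪ D` outside; the latter is compared with
the workload `-δ` of `D`, which costs the term `δ`. -/
theorem HasGap.proper_demand (H : HasGap M D α g δ) (t : Bool) {T : Finset (Dm ⊕ Sp)}
    (hne : T.Nonempty) (hT : ∀ v ∈ T, M.block D v = (true, t))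
    (hp : ∃ v, M.block D v = (true, t) ∧ v ∉ T) :
    ∑ v ∈ T, α v + g ≤ ∑ v ∈ nbr (M.noncross D) T, α v + δ := by
  obtain ⟨i' | j', hv, hvT⟩ := hp
  swap
  · simp [Model.block] at hv
  obtain ⟨i | j, hi⟩ := hne
  swap
  · simpa [Model.block] using hT _ hi
  cases t
  · have key := sum_sub_sum_nbr_of_notMem hT α
    have hiD : i ∉ D := by simpa [Model.block] using hT _ hi
    have hi'D : i' ∉ D := by simpa [Model.block] using hv
    have := H.gap ({i | Sum.inl i ∈ T} ∪ D) ⟨i, Or.inl hi⟩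
      (fun h => by
        have : i' ∈ ({i | Sum.inl i ∈ T} ∪ D) := by rw [h]; trivial
        exact this.elim hvT hi'D)
      (fun h => hiD (by rw [← h]; exact Or.inl hi))
    rw [H.workload] at key
    linarith
  · have key := sum_sub_sum_nbr_of_mem hT α
    have hi'D : i' ∈ D := by simpa [Model.block] using hv
    have hTD : ∀ i, Sum.inl i ∈ T → i ∈ D := fun i hi => by simpa [Model.block] using hT _ hi
    have := H.gap {i | Sum.inl i ∈ T} ⟨i, hi⟩
      (fun h => H.ne_univ (Set.eq_univ_of_univ_subset fun x _ => hTD x (by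
        have : x ∈ {i | Sum.inl i ∈ T} := by rw [h]; trivial
        exact this)))
      (fun h => hvT (by rw [← h] at hi'D; exact hi'D))
    linarith [H.nonneg]

/-- Only sets of demand classes enter the assumptions, so one passes to complements: the demand
classes not adjacent to `T` have all their neighbours outside `T`. The demand bound for them, with
the balance of the two blocks up to `δ`, gives the claim. -/
theorem HasGap.proper_supply (H : HasGap M D α g δ) (t : Bool) {T : Finset (Dm ⊕ Sp)}
    (hne : T.Nonempty) (hT : ∀ v ∈ T, M.block D v = (false, t))
    (hp : ∃ v, M.block D v = (false, t) ∧ v ∉ T) :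
    ∑ v ∈ T, α v + g ≤ ∑ v ∈ nbr (M.noncross D) T, α v + 2 * δ := by
  classical
  have hα : ∀ v, 0 ≤ α v := fun v => by linarith [H.le_rate v, H.lt, H.nonneg]
  set N := nbr (M.noncross D) T with hN
  set B := Finset.univ.filter fun v => M.block D v = (true, t) with hB
  set B' := Finset.univ.filter fun v => M.block D v = (false, t) with hB'
  have hNB : N ⊆ B := by
    intro v hv
    obtain ⟨u, hu, hr⟩ := mem_nbr.1 hv
    have := block_of_noncross _ _ (noncross_symm _ _ hr)
    rw [hT u hu] at this
    simpa [hB, opp] using this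
  have hTB : T ⊆ B' := fun v hv => by simp [hB', hT v hv]
  have hbal := H.blockSum_sub t
  have hbal' : ∑ v ∈ B', α v - ∑ v ∈ B, α v ≤ δ := by
    simp only [blockSum] at hbal
    split_ifs at hbal <;> linarith [H.nonneg]
  have e1 := Finset.sum_sdiff (f := α) hNB
  have e2 := Finset.sum_sdiff (f := α) hTB
  rcases (B \ N).eq_empty_or_nonempty with hE | hR
  -- Here `T` reaches the whole demand block, and the slack comes from the rate of a supply class
  -- missing from `T`.
  · obtain ⟨v, hv, hvT⟩ := hp
    have : α v ≤ ∑ v ∈ B' \ T, α v :=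
      Finset.single_le_sum (fun v _ => hα v) (by simp [hB', hv, hvT])
    rw [hE, Finset.sum_empty] at e1
    linarith [H.le_rate v, H.nonneg]
  · obtain ⟨u, hu⟩ := hne
    obtain ⟨v, hv⟩ := H.exists_noncross u
    have hvN : v ∈ N := mem_nbr.2 ⟨u, hu, noncross_symm _ _ hv⟩
    have := H.proper_demand t hR
      (fun v hv => (Finset.mem_filter.1 (Finset.mem_sdiff.1 hv).1).2)
      ⟨v, (Finset.mem_filter.1 (hNB hvN)).2, fun h => (Finset.mem_sdiff.1 h).2 hvN⟩
    have hsub : nbr (M.noncross D) (B \ N) ⊆ B' \ T := by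
      intro w hw
      obtain ⟨x, hx, hr⟩ := mem_nbr.1 hw
      obtain ⟨hxB, hxN⟩ := Finset.mem_sdiff.1 hx
      refine Finset.mem_sdiff.2 ⟨?_, fun hwT => hxN (mem_nbr.2 ⟨w, hwT, noncross_symm _ _ hr⟩)⟩
      have := block_of_noncross _ _ (noncross_symm _ _ hr)
      rw [(Finset.mem_filter.1 hxB).2] at this
      simpa [hB', opp] using this
    have := Finset.sum_le_sum_of_subset_of_nonneg hsub fun v _ _ => hα v
    linarith

theorem HasGap.proper (H : HasGap M D α g δ) (b : Bool × Bool) (T : Finset (Dm ⊕ Sp))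
    (hne : T.Nonempty) (hT : ∀ v ∈ T, M.block D v = b) (hp : ∃ v, M.block D v = b ∧ v ∉ T) :
    ∑ v ∈ T, α v + g ≤ ∑ v ∈ nbr (M.noncross D) T, α v + 2 * δ := by
  obtain ⟨_ | _, t⟩ := b
  · exact H.proper_supply t hne hT hp
  · linarith [H.proper_demand t hne hT hp, H.nonneg]

/-- The slack for the rates `α'` that remain if pairs `e` of a class outside of `D` and a class in
`𝒮(D)` are removed from the arrivals at the rate `η`. -/
theorem HasGap.hasSlack [DecidableEq Dm] [DecidableEq Sp] (H : HasGap M D α g δ) {η : ℝ}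
    {e : Dm × Sp} (he1 : e.1 ∉ D) (he2 : e.2 ∈ M.supplyOf D) (hη : 0 ≤ η)
    (hsmall : 2 * δ + 2 * η ≤ g / 2) {α' : Dm ⊕ Sp → ℝ}
    (hα' : ∀ k, α' k = α k - η * (pairVec e k : ℝ)) {q : Dm ⊕ Sp → ℕ} (hq : IsState q)
    (hw : η = 0 ∨ dot (M.xi D) (toReal q) < 0) {K : Finset (Dm ⊕ Sp)}
    (hK : ∀ v, v ∈ K ↔ 1 ≤ q v) :
    HasSlack (M.noncross D) (M.block D) α' (g / 2) δ K := by
  classical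
  have hδ := H.nonneg
  have hg : 0 < g := hδ.trans_lt H.lt
  have hsum : ∀ T : Finset (Dm ⊕ Sp), ∑ v ∈ T, α' v = ∑ v ∈ T, α v - η *
      ((if Sum.inl e.1 ∈ T then 1 else 0) + if Sum.inr e.2 ∈ T then 1 else 0) := by
    intro T
    simp only [hα', Finset.sum_sub_distrib, ← Finset.mul_sum, pairVec_eq, Nat.cast_add,
      Nat.cast_ite, Nat.cast_one, Nat.cast_zero, Finset.sum_add_distrib, Finset.sum_ite_eq']
  have hle : ∀ T : Finset (Dm ⊕ Sp), ∑ v ∈ T, α v - 2 * η ≤ ∑ v ∈ T, α' v ∧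
      ∑ v ∈ T, α' v ≤ ∑ v ∈ T, α v := by
    intro T
    rw [hsum]
    constructor <;> split_ifs <;> linarith
  refine ⟨noncross_symm, noncross_irrefl, fun v u u' h h' => ?_, by linarith, hδ, fun v => ?_,
    fun b T hne hT hp => ?_, fun b T hTI hne hT => ?_⟩
  · rw [block_of_noncross _ _ h, block_of_noncross _ _ h']
  · have := (hle {v}).1
    rw [Finset.sum_singleton, Finset.sum_singleton] at this
    linarith [H.le_rate v]
  · linarith [H.proper b T hne hT hp, (hle T).2, (hle (nbr (M.noncross D) T)).1]
  · have hN : ∀ v, v ∈ nbr (M.noncross D) T ↔ M.block D v = opp b := by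
      intro v
      rw [mem_nbr]
      constructor
      · rintro ⟨u, hu, hr⟩
        rw [block_of_noncross _ _ (noncross_symm _ _ hr), (hT u).1 hu]
      · intro hv
        obtain ⟨u, hu⟩ := H.exists_noncross v
        refine ⟨u, (hT u).2 ?_, hu⟩
        rw [block_of_noncross _ _ hu, hv]
        simp [opp]
    have hTs : ∀ x : Dm ⊕ Sp → ℝ, ∑ v ∈ T, x v = blockSum (M.block D) x b := by
      intro x
      refine Finset.sum_congr (Finset.ext fun v => ?_) fun _ _ => rfl
      simp [hT v]
    have hNs : ∀ x : Dm ⊕ Sp → ℝ, ∑ v ∈ nbr (M.noncross D) T, x v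
        = blockSum (M.block D) x (opp b) := by
      intro x
      refine Finset.sum_congr (Finset.ext fun v => ?_) fun _ _ => rfl
      simp [hN v]
    -- A fully isolated block faces an opposite block with no stock, which fixes the sign of the
    -- workload.
    have hq0 : blockSum (M.block D) (toReal q) (opp b) = 0 := by
      rw [← hNs]
      refine Finset.sum_eq_zero fun v hv => ?_
      obtain ⟨u, hu, hr⟩ := mem_nbr.1 hv
      have : v ∉ K := fun h => (mem_isolated.1 (hTI hu)).2 v h (noncross_symm _ _ hr)
      rw [hK] at this
      simp [toReal, Nat.lt_one_iff.1 (not_le.1 this)]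
    have hq1 : 0 ≤ blockSum (M.block D) (toReal q) b :=
      blockSum_nonneg _ (fun v => Nat.cast_nonneg _) _
    have hbe1 : M.block D (Sum.inl e.1) = (true, false) := by simp [Model.block, he1]
    have hbe2 : M.block D (Sum.inr e.2) = (false, true) := by simp [Model.block, he2]
    have hbal := H.blockSum_sub b.2
    rw [hsum, hsum, hTs, hNs]
    simp only [hT, hN, hbe1, hbe2]
    have hd0 : dot xi0 (toReal q) = 0 := hq
    rw [dot_xi0 (M := M) D] at hd0
    rw [dot_xi] at hw
    -- The removal of `e` takes `η` from the demand outside `D` and from `𝒮(D)`. This hurts only if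
    -- the isolated block is `D` or the supply outside `𝒮(D)`; in both cases the state has
    -- nonnegative workload, so `η = 0`.
    obtain ⟨_ | _, _ | _⟩ := b <;>
      simp [opp] at hbal hq0 hq1 ⊢ <;>
      rcases hw with rfl | hw <;> linarith

end Blocks

/-! ### Drift bounds at a single state. -/

section StatePolicy

variable {Dm Sp : Type*} [Fintype Dm] [Fintype Sp] [DecidableEq Dm] [DecidableEq Sp]
  {M : Model Dm Sp} {D : Set Dm} {K : Finset (Dm ⊕ Sp)}

theorem dot_marginal (x : Dm ⊕ Sp → ℝ) (p : Dm × Sp → ℝ) :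
    dot x (marginal p) = ∑ a, p a * dot x (toReal (pairVec a)) := by
  simp only [dot, marginal, Finset.mul_sum, toReal]
  rw [Finset.sum_comm]
  exact Finset.sum_congr rfl fun a _ => Finset.sum_congr rfl fun k _ => by ring

omit [Fintype Dm] [Fintype Sp] [DecidableEq Dm] [DecidableEq Sp] in
theorem dot_xi_pairVec {e : Dm × Sp} (he1 : e.1 ∉ D) (he2 : e.2 ∈ M.supplyOf D) :
    M.xi D (Sum.inl e.1) + M.xi D (Sum.inr e.2) = -1 := by
  simp [Model.xi, he1, he2]

/-- A match that is not a cross-match has `ξ`-weight zero, so the flow contributes nothing to the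
idleness. -/
theorem sum_xi_mul_flow {α : Dm ⊕ Sp → ℝ} {f : Dm ⊕ Sp → Dm ⊕ Sp → ℝ}
    (hf : f ∈ flowSet (M.noncross D) α K) :
    ∑ k, M.xi D k * (∑ u, f k u + ∑ u, f u k) = 0 := by
  have h1 : ∑ k, M.xi D k * (∑ u, f k u + ∑ u, f u k) =
      ∑ v, ∑ u, f v u * (M.xi D v + M.xi D u) := by
    simp only [mul_add, Finset.sum_add_distrib, Finset.mul_sum]
    congr 1
    · simp only [mul_comm]
    · rw [Finset.sum_comm]
      simp only [mul_comm]
  rw [h1]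
  refine Finset.sum_eq_zero fun v _ => Finset.sum_eq_zero fun u _ => ?_
  by_cases h : M.noncross D v u ∧ u ∈ K
  · rw [xi_add_xi_of_noncross h.1, mul_zero]
  · rw [hf.2.1 v u h, zero_mul]

/-- A law of the matching activities at a fixed state for which the mean drift is that of a given
flow, while the pair `e` is matched upon arrival at the rate `η`. -/
theorem exists_law_of_flow (hmax : 4 ≤ M.maxMatches) {p : Dm × Sp → ℝ} (hp : ∀ a, 0 ≤ p a)
    (hp1 : ∑ a, p a = 1) {e : Dm × Sp} (he1 : e.1 ∉ D) (he2 : e.2 ∈ M.supplyOf D) {η : ℝ}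
    (hη : 0 ≤ η) (hηp : η ≤ p e) (hηe : η ≠ 0 → e ∈ M.edges) {q : Dm ⊕ Sp → ℕ}
    (hK : ∀ v ∈ K, 1 ≤ q v) {α' : Dm ⊕ Sp → ℝ}
    (hα' : α' = fun k => marginal p k - η * (pairVec e k : ℝ))
    {f : Dm ⊕ Sp → Dm ⊕ Sp → ℝ} (hf : f ∈ flowSet (M.noncross D) α' K) :
    ∃ law : Dm × Sp → PMF (Dm × Sp → ℕ),
      (∀ a, ∀ n ∈ (law a).support, M.IsFeasible (q + pairVec a) n) ∧
      (η = 0 → ∀ a, ∀ n ∈ (law a).support, ∀ i j, i ∉ D → j ∈ M.supplyOf D → n (i, j) = 0) ∧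
      ∀ ψ : Policy M, ψ.law q = law →
        (∀ k, ψ.meanNext p q k = q k + drift α' f k) ∧
        (∀ k m, ψ.meanNextCost p q k m = M.cost k * q k + M.cost m * q m +
          (M.cost k * drift α' f k + M.cost m * drift α' f m)) ∧
        ψ.meanIdleness p D q = η ∧
        ψ.meanWorkloadDrift p D q = η + dot (M.xi D) (marginal p) := by
  -- Conditioned on the arrival of `e`, the forced match has probability `η / p e`, so it occurs at
  -- rate `η`; if `p e = 0` then `η = 0` too.
  set θ : Dm × Sp → ℝ := fun a => if a = e then η / p e else 0 with hθ_def
  have hpe : p e * (η / p e) = η := by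
    by_cases h : p e = 0
    · rw [h] at hηp ⊢
      rw [zero_mul, le_antisymm hηp hη]
    · field_simp
  have hpθ : ∀ a, p a * θ a = if a = e then η else 0 := by
    intro a
    simp only [hθ_def]
    split_ifs with h
    · rw [h, hpe]
    · rw [mul_zero]
  have hmθ : ∀ k, marginal (fun a => p a * θ a) k = η * (pairVec e k : ℝ) := by
    intro k
    simp [marginal, hpθ]
  have hm : ∀ k, marginal (fun a => p a * (1 - θ a)) k = α' k := by
    intro k
    rw [hα']
    beta_reduce
    rw [← hmθ]
    simp only [marginal, ← Finset.sum_sub_distrib]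
    exact Finset.sum_congr rfl fun a _ => by ring
  have hf' : f ∈ flowSet (M.noncross D) (marginal fun a => p a * (1 - θ a)) K := by
    rwa [show (marginal fun a => p a * (1 - θ a)) = α' from funext hm]
  obtain ⟨law, h1, h2, h3⟩ := exists_law hmax hp (θ := θ)
    (fun a => by
      simp only [hθ_def]
      split_ifs
      · exact ⟨div_nonneg hη (hp e), div_le_one_of_le₀ hηp (hp e)⟩
      · exact ⟨le_rfl, zero_le_one⟩)
    (fun a ha => by
      simp only [hθ_def] at ha
      split_ifs at ha with h
      · rw [h]
        exact hηe fun h0 => ha (by rw [h0, zero_div])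
      · exact absurd rfl ha) hK hf'
  refine ⟨law, h1, fun h0 a n hn => h2 a ?_ n hn, ?_⟩
  · simp [hθ_def, h0]
  rintro ψ rfl
  have hone : ∀ c : ℝ, ∑ a, p a * c = c := fun c => by rw [← Finset.sum_mul, hp1, one_mul]
  have hdrift : ∀ k, marginal p k - (η * (pairVec e k : ℝ) + (∑ u, f k u + ∑ u, f u k))
      = drift α' f k := by
    intro k
    simp only [drift, hα']
    ring
  refine ⟨fun k => ?_, fun k m => ?_, ?_, ?_⟩
  · have key := h3 (fun a => q k + (pairVec a k : ℝ)) (Pi.single k (-1))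
    have e1 : ∀ a n, nextState q a n k = q k + (pairVec a k : ℝ) +
        inputDot (Pi.single k (-1)) n := by
      intro a n
      simp [nextState, toReal, inputDot, Pi.single_apply]
      ring
    simp only [Policy.meanNext, Policy.condExp, e1]
    rw [key]
    simp only [mul_add, Finset.sum_add_distrib, hone, hmθ]
    simp only [Pi.single_apply, ite_mul, zero_mul, Finset.sum_ite_eq', Finset.mem_univ, if_true]
    rw [← hdrift, marginal]
    ring
  · have key := h3 (fun a => M.cost k * q k + M.cost m * q m +
      (M.cost k * (pairVec a k : ℝ) + M.cost m * (pairVec a m : ℝ)))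
      (Pi.single k (-M.cost k) + Pi.single m (-M.cost m))
    have e1 : ∀ a n, M.cost k * nextState q a n k + M.cost m * nextState q a n m =
        M.cost k * q k + M.cost m * q m +
        (M.cost k * (pairVec a k : ℝ) + M.cost m * (pairVec a m : ℝ)) +
        inputDot (Pi.single k (-M.cost k) + Pi.single m (-M.cost m)) n := by
      intro a n
      simp [nextState, toReal, inputDot, Pi.single_apply, add_mul, Finset.sum_add_distrib]
      ring
    simp only [Policy.meanNextCost, Policy.condExp, e1]
    rw [key]
    have e2 : ∀ k, ∑ a, p a * (M.cost k * (pairVec a k : ℝ)) = M.cost k * marginal p k := by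
      intro k
      rw [marginal, Finset.mul_sum]
      exact Finset.sum_congr rfl fun a _ => by ring
    simp only [mul_add (p _), Finset.sum_add_distrib, hone, hmθ, e2, Pi.add_apply, add_mul]
    simp only [Pi.single_apply, ite_mul, zero_mul, Finset.sum_ite_eq', Finset.mem_univ, if_true]
    rw [← hdrift, ← hdrift]
    ring
  · have key := h3 (fun _ => 0) fun k => -M.xi D k
    have e1 : ∀ n, -dot (M.xi D) (toReal (inputVec n)) =
        0 + inputDot (fun k => -M.xi D k) n := by
      intro n
      simp [dot, inputDot, toReal]
    simp only [Policy.meanIdleness, Policy.condExp, e1]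
    rw [key]
    have := sum_xi_mul_flow hf
    have h5 := dot_xi_pairVec (M := M) he1 he2
    simp only [hone, hmθ, neg_mul, mul_add (M.xi D _), Finset.sum_neg_distrib,
      Finset.sum_add_distrib] at this ⊢
    have e3 : ∑ k, M.xi D k * (η * (pairVec e k : ℝ)) = -η := by
      simp only [pairVec_eq, Nat.cast_add, Nat.cast_ite, Nat.cast_one, Nat.cast_zero, mul_add,
        Finset.sum_add_distrib, mul_ite, mul_one, mul_zero, Finset.sum_ite_eq', Finset.mem_univ,
        if_true]
      rw [← add_mul, h5]
      ring
    rw [e3]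
    linarith
  · have key := h3 (fun _ => dot (M.xi D) (marginal p)) fun k => -M.xi D k
    have e1 : ∀ a n, ∑ a', p a' * (dot (M.xi D) (nextState q a n + toReal (pairVec a'))
        - dot (M.xi D) (toReal q + toReal (pairVec a))) =
        dot (M.xi D) (marginal p) + inputDot (fun k => -M.xi D k) n := by
      intro a n
      have : ∀ a', dot (M.xi D) (nextState q a n + toReal (pairVec a'))
          - dot (M.xi D) (toReal q + toReal (pairVec a)) =
          dot (M.xi D) (toReal (pairVec a')) + inputDot (fun k => -M.xi D k) n := by
        intro a'
        simp only [dot, inputDot, nextState, ← Finset.sum_sub_distrib, ← Finset.sum_add_distrib]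
        refine Finset.sum_congr rfl fun k _ => ?_
        simp only [Pi.add_apply, Pi.sub_apply, toReal]
        ring
      simp only [this, mul_add, Finset.sum_add_distrib, hone, dot_marginal]
    simp only [Policy.meanWorkloadDrift, Policy.condExp, e1]
    rw [key]
    have := sum_xi_mul_flow hf
    have h5 := dot_xi_pairVec (M := M) he1 he2
    simp only [hone, hmθ, neg_mul, mul_add (M.xi D _), Finset.sum_neg_distrib,
      Finset.sum_add_distrib] at this ⊢
    have e3 : ∑ k, M.xi D k * (η * (pairVec e k : ℝ)) = -η := by
      simp only [pairVec_eq, Nat.cast_add, Nat.cast_ite, Nat.cast_one, Nat.cast_zero, mul_add,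
        Finset.sum_add_distrib, mul_ite, mul_one, mul_zero, Finset.sum_ite_eq', Finset.mem_univ,
        if_true]
      rw [← add_mul, h5]
      ring
    rw [e3]
    linarith

-- If every large buffer had minimal cost in a fully isolated block, `sum_cost_le` would bound the
-- cost by that of any competitor `x`. The constraints on `ξ⁰` and `ξ` give `x` the same balance as
-- `q` in each of the two parts, as that comparison requires.
omit [DecidableEq Dm] [DecidableEq Sp] in
theorem exists_large {g δ : ℝ} {α : Dm ⊕ Sp → ℝ} (H : HasGap M D α g δ)
    (hc : ∀ k, 0 < M.cost k) {qbar : ℝ} (hqbar : 1 ≤ qbar) {q : Dm ⊕ Sp → ℕ} (hq : IsState q)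
    (hK : ∀ v, v ∈ K ↔ 1 ≤ q v) {C : ℝ} (hC : ∀ k, M.cost k ≤ C) (hCdef : C = ⨆ k, M.cost k)
    (hexc : M.effCost D (dot (M.xi D) (toReal q)) + M.minCost qbar ≤ M.costOf (toReal q)) :
    ∃ k, qbar ≤ q k ∧ ((∃ v, M.block D v = M.block D k ∧ v ∉ isolated (M.noncross D) K) ∨
      ∃ m, M.block D m = M.block D k ∧ M.cost m < M.cost k) := by
  by_contra! hcon
  have hC0 : 0 ≤ C := by
    rw [hCdef]
    exact Real.iSup_nonneg fun k => (hc k).le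
  have key : M.costOf (toReal q) - Fintype.card (Dm ⊕ Sp) * (C * qbar) ≤
      M.effCost D (dot (M.xi D) (toReal q)) := by
    refine le_csInf ⟨_, toReal q, fun k => Nat.cast_nonneg _, hq, rfl, rfl⟩ ?_
    rintro _ ⟨x, hx, hx0, hxw, rfl⟩
    have hd : dot xi0 (toReal q) = 0 := hq
    rw [← hd, dot_xi0 (M := M) D, dot_xi0 (M := M) D] at hx0
    rw [dot_xi, dot_xi] at hxw
    have := sum_cost_le (r := M.noncross D) (blk := M.block D) (K := K) (c := M.cost)
      (q := toReal q) (x := x) (C := C) (qbar := qbar) noncross_symm H.exists_noncross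
      block_of_noncross (fun v => (hc v).le) hC (fun v => Nat.cast_nonneg _) hx
      (fun v hv => by
        rw [hK] at hv
        simp [toReal, Nat.lt_one_iff.1 (not_le.1 hv)])
      (by linarith) hC0 (fun k hk => hcon k hk)
      (fun t => by cases t <;> linarith)
    simp only [Model.costOf, dot]
    linarith
  have h0 : 0 ≤ (Fintype.card (Dm ⊕ Sp) : ℝ) * (C * qbar) :=
    mul_nonneg (Nat.cast_nonneg _) (mul_nonneg hC0 (by linarith))
  rw [Model.minCost, ← hCdef] at hexc
  -- The excess is at most `ℓ q̄ C`, below the threshold `1 + 4 ℓ q̄ C`.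
  nlinarith

omit [DecidableEq Dm] [DecidableEq Sp] in
theorem exists_other_nonempty {q : Dm ⊕ Sp → ℕ} (hq : IsState q) {k : Dm ⊕ Sp} (hk : 1 ≤ q k) :
    ∃ u, 1 ≤ q u ∧ u ≠ k := by
  by_contra! hcon
  have hd : dot xi0 (toReal q) = 0 := hq
  rw [dot, Finset.sum_eq_single k] at hd
  · have h1 : toReal q k ≠ 0 := by simp [toReal]; omega
    have h2 : (xi0 k : ℝ) ≠ 0 := by cases k <;> simp [xi0]
    exact mul_ne_zero h2 h1 hd
  · intro u _ hu
    have : q u = 0 := by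
      by_contra h
      exact hu (hcon u (by omega))
    simp [toReal, this]
  · simp

theorem exists_law_driftBounds (hmax : 4 ≤ M.maxMatches) {p : Dm × Sp → ℝ} (hp : ∀ a, 0 ≤ p a)
    (hp1 : ∑ a, p a = 1) {e : Dm × Sp} (he1 : e.1 ∉ D) (he2 : e.2 ∈ M.supplyOf D) {η g δ : ℝ}
    (H : HasGap M D (marginal p) g δ)
    (hη : 0 ≤ η) (hηp : η ≤ p e) (hηe : η ≠ 0 → e ∈ M.edges)
    (hsmall : 2 * δ + 2 * η ≤ g / 2) {κ : ℝ}
    (hκ : ∀ v, κ ≤ M.cost v) (hκ0 : 0 < κ)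
    (hκ' : ∀ v u, M.cost u < M.cost v → κ ≤ M.cost v - M.cost u)
    (hC : ∀ v, M.cost v ≤ ⨆ k, M.cost k) (hδ : 4 * (⨆ k, M.cost k) * δ ≤ κ * (g / 2))
    {qbar : ℝ} (hqbar : 1 ≤ qbar) {q : Dm ⊕ Sp → ℕ} (hq : IsState q)
    (hw : η = 0 ∨ dot (M.xi D) (toReal q) < 0) :
    ∃ law : Dm × Sp → PMF (Dm × Sp → ℕ),
      (∀ a, ∀ n ∈ (law a).support, M.IsFeasible (q + pairVec a) n) ∧
      (η = 0 → ∀ a, ∀ n ∈ (law a).support, ∀ i j, i ∉ D → j ∈ M.supplyOf D → n (i, j) = 0) ∧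
      ∀ ψ : Policy M, ψ.law q = law →
        ((M.costOf (toReal q) < M.effCost D (dot (M.xi D) (toReal q)) + M.minCost qbar →
            ∀ j, 1 ≤ q j → ψ.meanNext p q j ≤ q j + δ) ∧
          (M.effCost D (dot (M.xi D) (toReal q)) + M.minCost qbar ≤ M.costOf (toReal q) →
            ∃ k m, k ≠ m ∧ qbar ≤ q k ∧ 1 ≤ q m ∧
              ψ.meanNext p q k ≤ q k - g / 2 ∧
              ψ.meanNextCost p q k m ≤ M.cost k * q k + M.cost m * q m - κ * (g / 2) / 2 ∧
              ∀ j, j ≠ m → 1 ≤ q j → ψ.meanNext p q j ≤ q j + δ)) ∧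
        ψ.meanIdleness p D q = η ∧ ψ.meanWorkloadDrift p D q = η - δ := by
  classical
  set K : Finset (Dm ⊕ Sp) := Finset.univ.filter fun v => 1 ≤ q v with hK_def
  have hK : ∀ v, v ∈ K ↔ 1 ≤ q v := fun v => by simp [hK_def]
  have S := H.hasSlack he1 he2 hη hsmall
    (α' := fun k => marginal p k - η * (pairVec e k : ℝ)) (fun _ => rfl) hq hw hK
  by_cases hexc : M.effCost D (dot (M.xi D) (toReal q)) + M.minCost qbar ≤ M.costOf (toReal q)
  · obtain ⟨k, hk, hlarge⟩ := exists_large H (fun v => hκ0.trans_le (hκ v)) hqbar hq hK hC rfl hexc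
    have hk1 : 1 ≤ q k := by exact_mod_cast hqbar.trans hk
    obtain ⟨u, hu, huk⟩ := exists_other_nonempty hq hk1
    obtain ⟨f, hf, m, hm, hmk, f1, f2, f3⟩ := S.exists_flow_drift_neg hκ hκ0 hκ' hC hδ
      ((hK k).2 hk1) ⟨u, (hK u).2 hu, huk⟩ hlarge
    obtain ⟨law, l1, l2, l3⟩ := exists_law_of_flow hmax hp hp1 he1 he2 hη hηp hηe
      (fun v hv => (hK v).1 hv) rfl hf
    refine ⟨law, l1, l2, fun ψ hψ => ?_⟩
    obtain ⟨m1, m2, m3, m4⟩ := l3 ψ hψ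
    refine ⟨⟨fun h => absurd hexc (not_le.2 h), fun _ => ⟨k, m, hmk.symm, hk, (hK m).1 hm, ?_, ?_,
      fun j hj hqj => ?_⟩⟩, m3, by rw [m4, H.workload, sub_eq_add_neg]⟩
    · rw [m1]; linarith
    · rw [m2]; linarith
    · rw [m1]; linarith [f3 j ((hK j).2 hqj) hj]
  · obtain ⟨f, hf, f1⟩ := S.exists_flow_drift_le
    obtain ⟨law, l1, l2, l3⟩ := exists_law_of_flow hmax hp hp1 he1 he2 hη hηp hηe
      (fun v hv => (hK v).1 hv) rfl hf
    refine ⟨law, l1, l2, fun ψ hψ => ?_⟩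
    obtain ⟨m1, m2, m3, m4⟩ := l3 ψ hψ
    refine ⟨⟨fun _ j hj => ?_, fun h => absurd h hexc⟩, m3,
      by rw [m4, H.workload, sub_eq_add_neg]⟩
    rw [m1]
    linarith [f1 j ((hK j).2 hj)]

end StatePolicy

/-! ### Uniform constants from the heavy-traffic assumptions. -/

section Arrivals

theorem integral_comp_of_finite {Ω β : Type*} [MeasurableSpace Ω] [Fintype β] (P : Measure Ω)
    [IsProbabilityMeasure P] {Y : Ω → β} (hY : ∀ b, MeasurableSet {ω | Y ω = b}) (F : β → ℝ) :
    Integrable (fun ω => F (Y ω)) P ∧ ∫ ω, F (Y ω) ∂P = ∑ b, P.real {ω | Y ω = b} * F b := by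
  classical
  have h : (fun ω => F (Y ω)) = fun ω => ∑ b, {ω | Y ω = b}.indicator (fun _ => F b) ω := by
    ext ω
    simp [Set.indicator_apply]
  have hint : ∀ b, Integrable ({ω | Y ω = b}.indicator fun _ => F b) P := fun b =>
    (integrable_const (F b)).indicator (hY b)
  rw [h]
  refine ⟨integrable_finsetSum _ fun b _ => hint b, ?_⟩
  rw [integral_finsetSum _ fun b _ => hint b]
  refine Finset.sum_congr rfl fun b _ => ?_
  rw [integral_indicator_const _ (hY b), smul_eq_mul]

theorem exists_pos_le {ι : Type*} [Finite ι] (F : ι → ℝ) (hF : ∀ i, 0 < F i) :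
    ∃ κ > 0, ∀ i, κ ≤ F i := by
  rcases isEmpty_or_nonempty ι with _ | _
  · exact ⟨1, one_pos, fun i => isEmptyElim i⟩
  · obtain ⟨i, hi⟩ := Finite.exists_min F
    exact ⟨F i, hF i, hi⟩

variable {Dm Sp Ω : Type*} [Fintype Dm] [Fintype Sp] [DecidableEq Dm] [DecidableEq Sp]
  [MeasurableSpace Ω] {P : Measure Ω} [IsProbabilityMeasure P] {M : Model Dm Sp}
  {A : ℝ → ℕ → Ω → Dm × Sp} {δbar : ℝ} {D : Set Dm} {i₀ : Sp} {j₀ : Dm}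

omit [DecidableEq Dm] [DecidableEq Sp] [Fintype Dm] [Fintype Sp] in
theorem exists_edge [Nonempty Dm] [Nonempty Sp] (h : M.graph.Connected) :
    (∀ i, ∃ j, (i, j) ∈ M.edges) ∧ ∀ j, ∃ i, (i, j) ∈ M.edges := by
  have : Nontrivial (Dm ⊕ Sp) :=
    ⟨Sum.inl (Classical.arbitrary Dm), Sum.inr (Classical.arbitrary Sp), by simp⟩
  constructor
  · intro i
    obtain ⟨u, hu⟩ := h.preconnected.exists_adj_of_nontrivial (Sum.inl i)
    simp only [Model.graph, SimpleGraph.fromRel_adj] at hu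
    obtain ⟨-, ⟨i', j, h1, -, h3⟩ | ⟨i', j, -, h2, -⟩⟩ := hu
    · obtain rfl := Sum.inl_injective h1
      exact ⟨j, h3⟩
    · simp at h2
  · intro j
    obtain ⟨u, hu⟩ := h.preconnected.exists_adj_of_nontrivial (Sum.inr j)
    simp only [Model.graph, SimpleGraph.fromRel_adj] at hu
    obtain ⟨-, ⟨i, j', h1, -, -⟩ | ⟨i, j', -, h2, h3⟩⟩ := hu
    · simp at h1
    · obtain rfl := Sum.inr_injective h2
      exact ⟨i, h3⟩

omit [IsProbabilityMeasure P] in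
theorem HeavyTraffic.measurableSet (hA : HeavyTraffic M P A δbar D i₀ j₀) {δ : ℝ}
    (hδ : δ ∈ Icc 0 δbar) (a : Dm × Sp) : MeasurableSet {ω | A δ 0 ω = a} :=
  hA.measurable δ hδ 0 (show MeasurableSet[⊤] ({a} : Set (Dm × Sp)) from trivial)

theorem HeavyTraffic.rate_eq (hA : HeavyTraffic M P A δbar D i₀ j₀) {δ : ℝ}
    (hδ : δ ∈ Icc 0 δbar) : rate P A δ = marginal (arrivalProb P A δ) := by
  ext k
  exact (integral_comp_of_finite P (hA.measurableSet hδ) fun a => (pairVec a k : ℝ)).2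

theorem HeavyTraffic.sum_arrivalProb (hA : HeavyTraffic M P A δbar D i₀ j₀) {δ : ℝ}
    (hδ : δ ∈ Icc 0 δbar) : ∑ a, arrivalProb P A δ a = 1 := by
  have := (integral_comp_of_finite P (hA.measurableSet hδ) fun _ => (1 : ℝ)).2
  simpa [arrivalProb] using this.symm

/-- Each coordinate of the difference of two arrivals is bounded by its norm, so the rates inherit
the linear modulus; this keeps them bounded away from zero for small `δ`. -/
theorem HeavyTraffic.rate_sub_le (hA : HeavyTraffic M P A δbar D i₀ j₀) :
    ∃ b : ℝ, ∀ δ ∈ Icc 0 δbar, ∀ k, rate P A 0 k - b * δ ≤ rate P A δ k := by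
  obtain ⟨b, hb⟩ := hA.continuity
  refine ⟨b, fun δ hδ k => ?_⟩
  have h0 : (0 : ℝ) ∈ Icc 0 δbar := ⟨le_rfl, hA.δbar_pos.le⟩
  have i1 := (integral_comp_of_finite P (hA.measurableSet hδ) fun a => (pairVec a k : ℝ)).1
  have i0 := (integral_comp_of_finite P (hA.measurableSet h0) fun a => (pairVec a k : ℝ)).1
  have i2 := (integral_comp_of_finite P (Y := fun ω => (A δ 0 ω, A 0 0 ω)) (fun x => by
    have : {ω | (A δ 0 ω, A 0 0 ω) = x} = {ω | A δ 0 ω = x.1} ∩ {ω | A 0 0 ω = x.2} := by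
      ext ω
      simp [Prod.ext_iff]
    rw [this]
    exact (hA.measurableSet hδ _).inter (hA.measurableSet h0 _)) fun x =>
      ‖WithLp.toLp 2 (toReal (pairVec x.1) - toReal (pairVec x.2))‖).1
  have h1 : ∫ ω, ((pairVec (A 0 0 ω) k : ℝ) - pairVec (A δ 0 ω) k) ∂P ≤ b * δ := by
    refine le_trans (integral_mono (i0.sub i1) i2 fun ω => ?_) (hb δ hδ 0)
    have := PiLp.norm_apply_le (p := 2)
      (WithLp.toLp 2 (toReal (pairVec (A δ 0 ω)) - toReal (pairVec (A 0 0 ω)))) k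
    refine le_trans ?_ this
    simp only [Pi.sub_apply, toReal, Real.norm_eq_abs]
    rw [abs_sub_comm]
    exact le_abs_self _
  rw [integral_sub i0 i1] at h1
  simp only [rate]
  linarith

/-- Uniform constants for the drift bounds. -/
theorem HeavyTraffic.exists_constants (hM : M.Standing) (hA : HeavyTraffic M P A δbar D i₀ j₀) :
    ∃ δ₀ ∈ Ioo 0 δbar, ∃ g > 0, ∃ κ > 0, (∀ v, κ ≤ M.cost v) ∧
      (∀ v u, M.cost u < M.cost v → κ ≤ M.cost v - M.cost u) ∧
      (∀ v, M.cost v ≤ ⨆ k, M.cost k) ∧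
      ∀ δ ∈ Icc 0 δ₀, HasGap M D (marginal (arrivalProb P A δ)) g δ ∧
        (∑ a, arrivalProb P A δ a = 1) ∧ g ≤ arrivalProb P A δ (j₀, i₀) ∧ δ ≤ g / 16 ∧
        4 * (⨆ k, M.cost k) * δ ≤ κ * (g / 2) := by
  have : Nonempty Dm := ⟨j₀⟩
  have : Nonempty Sp := ⟨i₀⟩
  obtain ⟨hleft, hright⟩ := exists_edge hM.connected
  obtain ⟨κ₁, hκ₁, hκ₁'⟩ := exists_pos_le M.cost hM.cost_pos
  obtain ⟨κ₂, hκ₂, hκ₂'⟩ := exists_pos_le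
    (fun x : (Dm ⊕ Sp) × (Dm ⊕ Sp) =>
      if M.cost x.2 < M.cost x.1 then M.cost x.1 - M.cost x.2 else 1)
    (fun x => by
      split_ifs with h
      · exact sub_pos.2 h
      · exact one_pos)
  obtain ⟨a, ha, ha'⟩ := exists_pos_le (rate P A 0) hA.rate_pos
  obtain ⟨γ, hγ, hγ'⟩ := hA.gap
  obtain ⟨pI, hpI, hpI'⟩ := hA.joint
  obtain ⟨b, hb⟩ := hA.rate_sub_le
  have hC : ∀ v, M.cost v ≤ ⨆ k, M.cost k := fun v => le_ciSup (Set.finite_range M.cost).bddAbove v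
  have hC0 : 0 < ⨆ k, M.cost k := (hM.cost_pos (Sum.inl j₀)).trans_le (hC _)
  set C := ⨆ k, M.cost k
  set κ := min κ₁ κ₂ with hκ_def
  have hκ : 0 < κ := lt_min hκ₁ hκ₂
  set g := min γ (min (a / 2) pI) with hg_def
  have hg : 0 < g := lt_min hγ (lt_min (half_pos ha) hpI)
  have hδbar := hA.δbar_pos
  have hb1 : 0 < |b| + 1 := by positivity
  -- The four bounds on `δ` serve, in order: strict inclusion in the given range, the Hall slack
  -- left after removing forced matches, rates at least `a / 2`, and the domination of the `δ` terms
  -- in the cost drift.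
  refine ⟨min (δbar / 2) (min (g / 16) (min (a / 2 / (|b| + 1)) (κ * (g / 2) / (4 * C)))),
    ⟨by positivity, (min_le_left _ _).trans_lt (half_lt_self hδbar)⟩, g, hg, κ, hκ,
    fun v => (min_le_left _ _).trans (hκ₁' v), fun v u h => ?_, hC, fun δ hδ => ?_⟩
  · have := hκ₂' (v, u)
    rw [if_pos h] at this
    exact (min_le_right _ _).trans this
  · obtain ⟨hδ0, hδ1⟩ := hδ
    rw [le_min_iff, le_min_iff, le_min_iff] at hδ1
    obtain ⟨d1, d2, d3, d4⟩ := hδ1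
    have hδ : δ ∈ Icc 0 δbar := ⟨hδ0, by linarith⟩
    have hrate := hA.rate_eq hδ
    have hsum := hA.sum_arrivalProb hδ
    refine ⟨⟨hleft, hright, hA.D_ne_univ, fun D' h1 h2 h3 => ?_, ?_, ?_, fun k => ?_, hδ0,
      by linarith⟩, hsum, ?_, d2, ?_⟩
    · rw [← hrate]
      exact (hγ' D' h1 h2 h3 δ hδ).trans (neg_le_neg (min_le_left _ _))
    · rw [dot_marginal]
      refine Finset.sum_eq_zero fun a _ => ?_
      simp [dot, xi0, toReal, pairVec]
    · rw [← hrate]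
      exact hA.workload δ hδ
    · rw [← hrate]
      have h1 := hb δ hδ k
      have h2 := ha' k
      have h3 : (|b| + 1) * δ ≤ a / 2 := by
        rw [le_div_iff₀ hb1] at d3
        linarith
      have h4 : b * δ ≤ (|b| + 1) * δ :=
        mul_le_mul_of_nonneg_right (by linarith [le_abs_self b]) hδ0
      have h5 : g ≤ a / 2 := (min_le_right _ _).trans (min_le_left _ _)
      linarith
    · exact ((min_le_right _ _).trans (min_le_right _ _)).trans (hpI' δ hδ 0)
    · rw [le_div_iff₀ (by positivity)] at d4
      linarith

theorem exists_policy (Q : (Dm ⊕ Sp → ℕ) → (Dm × Sp → PMF (Dm × Sp → ℕ)) → Prop)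
    (hQ : ∀ q, ∃ law : Dm × Sp → PMF (Dm × Sp → ℕ),
      (∀ a, ∀ n ∈ (law a).support, M.IsFeasible (q + pairVec a) n) ∧ Q q law) :
    ∃ ψ : Policy M, ∀ q, Q q (ψ.law q) := by
  choose law h1 h2 using hQ
  exact ⟨⟨law, h1⟩, h2⟩

/-- A policy must be defined on all vectors; on unbalanced ones, where no drift bound is claimed, it
makes no match. -/
theorem exists_idle_law (M : Model Dm Sp) (q : Dm ⊕ Sp → ℕ) :
    ∃ law : Dm × Sp → PMF (Dm × Sp → ℕ),
      (∀ a, ∀ n ∈ (law a).support, M.IsFeasible (q + pairVec a) n) ∧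
      ∀ a, ∀ n ∈ (law a).support, n = 0 := by
  refine ⟨fun _ => PMF.pure 0, fun a n hn => ?_, fun a n hn => by simpa using hn⟩
  obtain rfl : n = 0 := by simpa using hn
  exact ⟨fun _ _ => rfl, by simp, fun k => by simp [inputVec_zero]⟩

end Arrivals

end BipartiteMatching

end

/-! ### Assembly of the two policies. -/

open BipartiteMatching in
theorem lemmat {Dm Sp Ω : Type*} [Fintype Dm] [Fintype Sp] [DecidableEq Dm] [DecidableEq Sp]
    [MeasurableSpace Ω] (P : Measure Ω) [IsProbabilityMeasure P]
    (M : Model Dm Sp) (hM : M.Standing)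
    (A : ℝ → ℕ → Ω → Dm × Sp) (δbar : ℝ) (D : Set Dm) (i₀ : Sp) (j₀ : Dm)
    (hA : HeavyTraffic M P A δbar D i₀ j₀) :
    (∃ δ₀ ∈ Ioo 0 δbar, ∃ ε₀ > 0, ∃ ε₀' > 0,
      ∀ qbar : ℝ, 1 ≤ qbar → ∀ δ ∈ Icc 0 δ₀,
        ∃ ψ : Policy M, (∀ q, ψ.NoCrossMatchingAt D q) ∧
          ψ.DriftBounds (arrivalProb P A δ) D δ qbar ε₀ ε₀') ∧
    ((j₀, i₀) ∈ M.edges →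
      ∃ δ₀ ∈ Ioo 0 δbar, ∃ ε₀ > 0, ∃ ε₀' > 0, ∃ δ₁ > 0,
        ∀ qbar : ℝ, 1 ≤ qbar → ∀ δplus ∈ Ioo 0 δ₁, ∀ δ ∈ Icc 0 δ₀, ∀ τ : ℝ, 0 ≤ τ →
          ∃ ψ : Policy M, ψ.DriftBounds (arrivalProb P A δ) D δ qbar ε₀ ε₀' ∧
            ∀ q, IsState q →
              (-τ ≤ dot (M.xi D) (toReal q) → ψ.NoCrossMatchingAt D q) ∧
              (dot (M.xi D) (toReal q) < -τ →
                ψ.meanIdleness (arrivalProb P A δ) D q - δ = δplus ∧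
                ψ.meanWorkloadDrift (arrivalProb P A δ) D q = δplus)) := by
  obtain ⟨δ₀, hδ₀, g, hg, κ, hκ, c1, c2, c3, hall⟩ := hA.exists_constants hM
  have hp : ∀ δ a, 0 ≤ arrivalProb P A δ a := fun δ a => measureReal_nonneg
  have key : ∀ δ ∈ Icc 0 δ₀, ∀ qbar : ℝ, 1 ≤ qbar → ∀ η : ℝ, 0 ≤ η → η ≤ g / 8 →
      (η ≠ 0 → (j₀, i₀) ∈ M.edges) → ∀ q, IsState q →
      (η = 0 ∨ dot (M.xi D) (toReal q) < 0) → _ := fun δ hδ qbar hqbar η hη hη8 hηe q hq hw =>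
    exists_law_driftBounds (e := (j₀, i₀)) hM.four_le (hp δ) (hall δ hδ).2.1 hA.j₀_notMem hA.i₀_mem
      (hall δ hδ).1 hη (by linarith [(hall δ hδ).2.2.1]) hηe
      (by linarith [(hall δ hδ).2.2.2.1]) c1 hκ c2 c3 (hall δ hδ).2.2.2.2 hqbar hq hw
  have hε : 0 < κ * (g / 2) / 2 := by positivity
  refine ⟨⟨δ₀, hδ₀, g / 2, half_pos hg, _, hε, fun qbar hqbar δ hδ => ?_⟩, fun hedge =>
    ⟨δ₀, hδ₀, g / 2, half_pos hg, _, hε, g / 16, by positivity,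
      fun qbar hqbar δplus hδp δ hδ τ hτ => ?_⟩⟩
  · obtain ⟨ψ, hψ⟩ := exists_policy (M := M) (fun q law =>
      (∀ a, ∀ n ∈ (law a).support, ∀ i j, i ∉ D → j ∈ M.supplyOf D → n (i, j) = 0) ∧
      (IsState q → ∀ ψ : Policy M, ψ.law q = law → _)) (fun q => by
        by_cases hq : IsState q
        · obtain ⟨law, h1, h2, h3⟩ := key δ hδ qbar hqbar 0 le_rfl (by positivity)
            (fun h => absurd rfl h) q hq (Or.inl rfl)
          exact ⟨law, h1, h2 rfl, fun _ => h3⟩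
        · obtain ⟨law, h1, h2⟩ := exists_idle_law M q
          exact ⟨law, h1, fun a n hn i j _ _ => by rw [h2 a n hn]; rfl, fun h => absurd h hq⟩)
    exact ⟨ψ, fun q => (hψ q).1, fun q hq => ((hψ q).2 hq ψ rfl).1⟩
  · obtain ⟨ψ, hψ⟩ := exists_policy (M := M) (fun q law => IsState q →
      (-τ ≤ dot (M.xi D) (toReal q) →
        ∀ a, ∀ n ∈ (law a).support, ∀ i j, i ∉ D → j ∈ M.supplyOf D → n (i, j) = 0) ∧
      ∀ ψ : Policy M, ψ.law q = law → _ ∧ (dot (M.xi D) (toReal q) < -τ → _)) (fun q => by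
        by_cases hq : IsState q
        · by_cases hw : dot (M.xi D) (toReal q) < -τ
          -- The mean idleness is `η` and the workload drift `η - δ`, which dictates `η = δ +
          -- δplus`; it is at most `g / 8` because both terms are at most `g / 16`. The workload is
          -- negative here since `τ ≥ 0`.
          · obtain ⟨law, h1, h2, h3⟩ := key δ hδ qbar hqbar (δ + δplus)
              (by linarith [hδ.1, hδp.1]) (by linarith [(hall δ hδ).2.2.2.1, hδp.2])
              (fun _ => hedge) q hq (Or.inr (by linarith))
            exact ⟨law, h1, fun _ => ⟨fun h => absurd hw (not_lt.2 h), fun ψ hψ =>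
              ⟨(h3 ψ hψ).1, fun _ => (h3 ψ hψ).2⟩⟩⟩
          · obtain ⟨law, h1, h2, h3⟩ := key δ hδ qbar hqbar 0 le_rfl (by positivity)
              (fun h => absurd rfl h) q hq (Or.inl rfl)
            exact ⟨law, h1, fun _ => ⟨fun _ => h2 rfl, fun ψ hψ =>
              ⟨(h3 ψ hψ).1, fun h => absurd h hw⟩⟩⟩
        · obtain ⟨law, h1, h2⟩ := exists_idle_law M q
          exact ⟨law, h1, fun h => absurd h hq⟩)
    refine ⟨ψ, fun q hq => ((hψ q hq).2 ψ rfl).1, fun q hq => ⟨(hψ q hq).1, fun hw => ?_⟩⟩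
    obtain ⟨h1, h2⟩ := ((hψ q hq).2 ψ rfl).2 hw
    exact ⟨by rw [h1]; ring, by rw [h2]; ring⟩
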